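/- Let $dA(w)=\pi^{-1}\,dx\,dy$ ($w=x+iy$) be the normalized area measure on $\mathbb C$, and fix an integer $q\ge 1$. For real $m>0$ and an integer $n\ge 1$ let $\mathrm{Pol}_{m,n,q}$ be the complex span of the functions $z^j\bar z^k$, $0\le j\le n-1$, $0\le k\le q-1$, with the inner product $\langle f,h\rangle=\int_{\mathbb C} f\,\bar h\,e^{-m|w|^2}\,dA(w)$, let $K_{m,n,q}$ be its reproducing kernel, and let $$b^{\langle z\rangle}_{m,n,q}(w)=\frac{|K_{m,n,q}(z,w)|^2}{K_{m,n,q}(z,z)}\,e^{-m|w|^2}$$ be the Berezin density at $z\in\mathbb C$. Let $\mathbb D^e=\{w\in\mathbb C:|w|>1\}$, and for $z\in\mathbb D^e$ let $\omega_z$ be the harmonic measure at $z$ with respect to $\mathbb D^e$, that is, the unique Borel probability measure carried by the unit circle with $u(z)=\int u\,d\omega_z$ for every bounded real function $u$ that is harmonic in $\mathbb D^e$ and continuous on $\overline{\mathbb D^e}$. **Theorem.** Fix $z\in\mathbb D^e$ and a bounded continuous function $g:\mathbb C\to\mathbb C$. Then $$\int_{\mathbb C} g(w)\,b^{\langle z\rangle}_{m,n,q}(w)\,dA(w)\longrightarrow\int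 g\,d\omega_z$$ as $m,n\to+\infty$ with $n=m+O(1)$; that is, for every $M\ge 0$ the convergence holds as $m,n\to+\infty$ along the pairs with $|n-m|\le M$. -/

import Mathlib

open Filter Topology MeasureTheory

/-- The normalized area measure `dA = π⁻¹ dx dy` on the complex plane. -/
noncomputable def normalizedArea : Measure ℂ :=
  ENNReal.ofReal Real.pi⁻¹ • (volume : Measure ℂ)

/-- The polyanalytic polynomials `Pol_{n,q}`: the complex span of the functions `z ^ j * conj z ^ k`
with `0 ≤ j ≤ n - 1` and `0 ≤ k ≤ q - 1`. -/
def polyanalyticPol (n q : ℕ) : Submodule ℂ (ℂ → ℂ) :=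
  Submodule.span ℂ
    {f | ∃ j k : ℕ, j < n ∧ k < q ∧ f = fun z : ℂ => z ^ j * (starRingEnd ℂ z) ^ k}

/-- `K` is a reproducing kernel of the space of functions `V`, with the inner product
`⟨f, g⟩ = ∫ f(z) conj(g(z)) exp(-m|z|²) dA(z)` of `L²(ℂ, exp(-m|z|²) dA)`: every `K(·, w)` lies
in `V`, and `f(w) = ⟨f, K(·, w)⟩` for all `f` in `V`. -/
def IsReproducingKernel (m : ℝ) (V : Submodule ℂ (ℂ → ℂ)) (K : ℂ → ℂ → ℂ) : Prop :=
  ∀ w : ℂ, (fun z => K z w) ∈ V ∧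
    ∀ f ∈ V, f w = ∫ z, f z * starRingEnd ℂ (K z w) * (Real.exp (-(m * ‖z‖ ^ 2)) : ℂ)
      ∂normalizedArea

/-- A space has at most one reproducing kernel. -/
theorem IsReproducingKernel.unique {m : ℝ} {V : Submodule ℂ (ℂ → ℂ)} {K L : ℂ → ℂ → ℂ}
    (hK : IsReproducingKernel m V K) (hL : IsReproducingKernel m V L) : K = L := by
  have key : ∀ {P Q : ℂ → ℂ → ℂ}, IsReproducingKernel m V P → IsReproducingKernel m V Q →
      ∀ a b : ℂ, P a b = starRingEnd ℂ (Q b a) := by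
    intro P Q hP hQ a b
    rw [(hQ a).2 _ (hP b).1, (hP b).2 _ (hQ a).1, ← integral_conj]
    refine integral_congr_ae (Eventually.of_forall fun x => ?_)
    simp only [map_mul, Complex.conj_conj, Complex.conj_ofReal]
    ring
  funext a b
  rw [key hK hL a b, key hL hL a b]

open Classical in
/-- The reproducing kernel `K_{m,n,q}` of `Pol_{m,n,q}`, i.e. of `Pol_{n,q}` with the inner product
of `L²(ℂ, exp(-m|z|²) dA)`. For `m > 0` it exists, the space being finite-dimensional, and it is
unique by `IsReproducingKernel.unique`. -/
noncomputable def polyKernel (m : ℝ) (n q : ℕ) : ℂ → ℂ → ℂ :=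
  if h : ∃ K, IsReproducingKernel m (polyanalyticPol n q) K then h.choose else 0

/-- The Berezin density `w ↦ |K_{m,n,q}(z,w)|² / K_{m,n,q}(z,z) * exp(-m|w|²)`; the diagonal value
`K_{m,n,q}(z,z)` is real. -/
noncomputable def berezinDensity (m : ℝ) (n q : ℕ) (z w : ℂ) : ℝ :=
  ‖polyKernel m n q z w‖ ^ 2 / (polyKernel m n q z z).re * Real.exp (-(m * ‖w‖ ^ 2))

/-- The exterior disk `{w : |w| > 1}`. -/
def exteriorDisk : Set ℂ := {w : ℂ | 1 < ‖w‖}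

/-- `ω` is a harmonic measure at `z` with respect to `Ω`: a probability measure carried by `∂Ω` such
that the value at `z` of a bounded solution `u` of a Dirichlet problem in `Ω` is the `ω`-average of
its boundary values. Boundedness of `u` matters for unbounded `Ω`: it means that the point at
infinity carries no mass (for the exterior disk, that `u` is also harmonic at infinity). -/
structure IsHarmonicMeasure (Ω : Set ℂ) (z : ℂ) (ω : Measure ℂ) : Prop where
  isProbabilityMeasure : IsProbabilityMeasure ω
  carried : ω (frontier Ω)ᶜ = 0
  dirichlet : ∀ u : ℂ → ℝ, InnerProductSpace.HarmonicContOnCl u Ω →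
    (∃ C : ℝ, ∀ w ∈ Ω, |u w| ≤ C) → u z = ∫ w in frontier Ω, u w ∂ω

open Classical in
/-- The harmonic measure at `z` with respect to `Ω`, for a set `Ω` (such as the exterior disk) in
which the Dirichlet problem is solvable, so that exactly one measure has the defining property. -/
noncomputable def harmonicMeasure (Ω : Set ℂ) (z : ℂ) : Measure ℂ :=
  if h : ∃! ω, IsHarmonicMeasure Ω z ω then h.choose else 0

/-- The mode of convergence `m, n → +∞` with `|n - m| ≤ M`, for real `m` and integer `n`. -/
def nearDiagonal (M : ℝ) : Filter (ℝ × ℕ) :=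
  (atTop ×ˢ atTop) ⊓ 𝓟 {p : ℝ × ℕ | |(p.2 : ℝ) - p.1| ≤ M}

/-!
Let `ψ = K(·, z) / √K(z, z)` be the Berezin state at an exterior point `z`: a unit vector of
`Pol_{m,n,q}` such that `f(z) = √K(z, z) ⟨f, ψ⟩` for all `f` in the space, and whose squared
modulus, times the weight, is the Berezin density. No asymptotic expansion of the kernel is needed.
It is enough to know how multiplication by `w` and by `conj w` act, and this can be read off from
the orthonormal basis `e_{j,k}` of complex Hermite polynomials, in which
`w e_{j,k} = √((j+1)/m) e_{j+1,k} + √(k/m) e_{j,k-1}` and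
`conj w e_{j,k} = √((k+1)/m) e_{j,k+1} + √(j/m) e_{j-1,k}`.
As `m, n → ∞` with `n = m + O(1)`, these are nearly shifts of the index `j` for `j` close to `n`.

* Concentration on the circle. The part `f` of `ψ` with `j < n - s` satisfies
  `|z|^s ‖f‖² = |⟨w^s f, ψ⟩| ≤ ‖w^s f‖`, by evaluation of `f` and of `w^s f`, which is still in
  the space, at `z`. Since `w` acts with norm `1 + o(1)`, the norm of `f` is at most about `|z|^{-s}`
  (`norm_pow_mul_fockNorm_fockProj_le`). On the remaining modes, `|w|² - 1` acts with small norm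
  (`fockNorm_sq_sub_one_mul_le`). Hence `(|w|² - 1) ψ → 0`, even with polynomial weights
  (`tendsto_integral_sq_sub_one_mul_berezinState`).
* Moments. Up to `O(m^{-1/2})`, the function `conj w ^ s ψ` is some `φ` with degree in `w` below
  `n - s`. Then `w^s φ` is in the space, so that `z^s ⟨φ, ψ⟩ = ⟨w^s φ, ψ⟩`, and the right side tends
  to `⟨ψ, ψ⟩ = 1` because `|w|^{2s} ψ` is close to `ψ`. So the moment `∫ conj w ^ s |ψ|²` tends to
  `z^{-s}` (`tendsto_fockInner_conj_pow_mul_berezinState`).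

The method of moments (`tendsto_integral_of_tendsto_moments`) turns these two facts into convergence
to the probability measure on the circle with moments `∫ conj w ^ s = z^{-s}`. That measure is given
by the Poisson kernel of the unit disk at `1 / conj z`. It is the only harmonic measure at `z`
(`harmonicMeasure_exteriorDisk`), by uniform approximation of boundary values by trigonometric
polynomials, which have explicit bounded harmonic extensions, and by the maximum principle for
bounded harmonic functions in the exterior disk.
-/

/-! ### Functions of polynomial growth and the Gaussian measure -/

/-- The Gaussian measure `exp(-m|w|²) dA(w)` on the complex plane. -/
noncomputable def fockMeasure (m : ℝ) : Measure ℂ :=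
  normalizedArea.withDensity fun w => ENNReal.ofReal (Real.exp (-(m * ‖w‖ ^ 2)))

/-- Continuous functions `f : ℂ → ℂ` of at most polynomial growth. -/
def PolyGrowth (f : ℂ → ℂ) : Prop :=
  Continuous f ∧ ∃ (D : ℝ) (d : ℕ), ∀ w, ‖f w‖ ≤ D * (1 + ‖w‖ ^ 2) ^ d

namespace PolyGrowth

variable {f g : ℂ → ℂ}

theorem exists_bound (hf : PolyGrowth f) :
    ∃ (D : ℝ) (d : ℕ), 0 ≤ D ∧ ∀ w, ‖f w‖ ≤ D * (1 + ‖w‖ ^ 2) ^ d := by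
  obtain ⟨_, D, d, h⟩ := hf
  refine ⟨D, d, ?_, h⟩
  simpa using (norm_nonneg _).trans (h 0)

theorem of_bounded (hf : Continuous f) {C : ℝ} (h : ∀ w, ‖f w‖ ≤ C) : PolyGrowth f :=
  ⟨hf, C, 0, by simpa using h⟩

theorem const (c : ℂ) : PolyGrowth fun _ => c :=
  of_bounded continuous_const fun _ => le_rfl

theorem id : PolyGrowth fun w => w := by
  refine ⟨continuous_id, 1, 1, fun w => ?_⟩
  nlinarith [sq_nonneg (‖w‖ - 1), sq_nonneg ‖w‖]

theorem congr_norm (hf : PolyGrowth f) (hg : Continuous g) (h : ∀ w, ‖g w‖ = ‖f w‖) :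
    PolyGrowth g := by
  obtain ⟨_, D, d, hD⟩ := hf
  exact ⟨hg, D, d, fun w => (h w).le.trans (hD w)⟩

theorem conj (hf : PolyGrowth f) : PolyGrowth fun w => starRingEnd ℂ (f w) :=
  hf.congr_norm (Complex.continuous_conj.comp hf.1) fun _ => Complex.norm_conj _

theorem mul (hf : PolyGrowth f) (hg : PolyGrowth g) : PolyGrowth fun w => f w * g w := by
  obtain ⟨D, d, hD0, hD⟩ := hf.exists_bound
  obtain ⟨E, e, hE0, hE⟩ := hg.exists_bound
  refine ⟨hf.1.mul hg.1, D * E, d + e, fun w => ?_⟩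
  calc ‖f w * g w‖ ≤ (D * (1 + ‖w‖ ^ 2) ^ d) * (E * (1 + ‖w‖ ^ 2) ^ e) := by
        rw [norm_mul]; gcongr
        exacts [hD w, hE w]
    _ = _ := by ring

theorem add (hf : PolyGrowth f) (hg : PolyGrowth g) : PolyGrowth fun w => f w + g w := by
  obtain ⟨D, d, hD0, hD⟩ := hf.exists_bound
  obtain ⟨E, e, hE0, hE⟩ := hg.exists_bound
  refine ⟨hf.1.add hg.1, D + E, max d e, fun w => ?_⟩
  have h1 : (1 : ℝ) ≤ 1 + ‖w‖ ^ 2 := by nlinarith [sq_nonneg ‖w‖]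
  calc ‖f w + g w‖ ≤ D * (1 + ‖w‖ ^ 2) ^ d + E * (1 + ‖w‖ ^ 2) ^ e :=
        (norm_add_le _ _).trans (add_le_add (hD w) (hE w))
    _ ≤ D * (1 + ‖w‖ ^ 2) ^ (max d e) + E * (1 + ‖w‖ ^ 2) ^ (max d e) := by
        gcongr
        exacts [le_max_left _ _, le_max_right _ _]
    _ = _ := by ring

theorem const_mul (c : ℂ) (hf : PolyGrowth f) : PolyGrowth fun w => c * f w := (const c).mul hf

theorem neg (hf : PolyGrowth f) : PolyGrowth fun w => -f w := by
  simpa using hf.const_mul (-1)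

theorem sub (hf : PolyGrowth f) (hg : PolyGrowth g) : PolyGrowth fun w => f w - g w := by
  simpa [sub_eq_add_neg] using hf.add hg.neg

theorem pow (hf : PolyGrowth f) (n : ℕ) : PolyGrowth fun w => f w ^ n := by
  induction n with
  | zero => simpa using const 1
  | succ n ih => simpa [pow_succ] using ih.mul hf

theorem sum {ι : Type*} (s : Finset ι) {F : ι → ℂ → ℂ} (h : ∀ i ∈ s, PolyGrowth (F i)) :
    PolyGrowth fun w => ∑ i ∈ s, F i w := by
  classical
  induction s using Finset.induction_on with
  | empty => simpa using const 0
  | insert a s ha ih =>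
    simp only [Finset.sum_insert ha]
    exact (h a (by simp)).add (ih fun i hi => h i (by simp [hi]))

end PolyGrowth

theorem integral_fockMeasure (m : ℝ) (f : ℂ → ℂ) :
    ∫ w, f w ∂fockMeasure m
      = ∫ w, f w * (Real.exp (-(m * ‖w‖ ^ 2)) : ℂ) ∂normalizedArea := by
  rw [fockMeasure, integral_withDensity_eq_integral_toReal_smul (by fun_prop)
    (Eventually.of_forall fun _ => ENNReal.ofReal_lt_top)]
  refine integral_congr_ae (Eventually.of_forall fun w => ?_)
  simp only [ENNReal.toReal_ofReal (Real.exp_pos _).le, Complex.real_smul, mul_comm]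

theorem integral_normalizedArea (f : ℂ → ℂ) :
    ∫ w, f w ∂normalizedArea = (Real.pi⁻¹ : ℝ) • ∫ w, f w := by
  rw [normalizedArea, integral_smul_measure, ENNReal.toReal_ofReal (by positivity)]

theorem integral_norm_pow_mul_exp {m : ℝ} (hm : 0 < m) (d : ℕ) :
    ∫ w : ℂ, (‖w‖ ^ 2) ^ d * Real.exp (-(m * ‖w‖ ^ 2))
      = Real.pi * (d.factorial / m ^ (d + 1)) := by
  have h := Complex.integral_rpow_mul_exp_neg_mul_rpow (p := 2) (q := 2 * d) (b := m)
    (by norm_num) (by have := d.cast_nonneg (α := ℝ); linarith) hm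
  have h1 : ((2 : ℝ) * d + 2) / 2 = d + 1 := by ring
  have h2 : -((2 : ℝ) * d + 2) / 2 = -((d + 1 : ℕ) : ℝ) := by push_cast; ring
  rw [h1, h2, Real.Gamma_nat_eq_factorial, Real.rpow_neg hm.le, Real.rpow_natCast] at h
  calc _ = ∫ x : ℂ, ‖x‖ ^ ((2 : ℝ) * d) * Real.exp (-m * ‖x‖ ^ (2 : ℝ)) := by
        congr 1; ext w
        rw [show ((2 : ℝ) * d) = ((2 * d : ℕ) : ℝ) by push_cast; ring, Real.rpow_natCast,
          Real.rpow_two, pow_mul, neg_mul]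
    _ = _ := by rw [h]; field_simp

theorem integrable_norm_pow_mul_exp {m : ℝ} (hm : 0 < m) (d : ℕ) :
    Integrable fun w : ℂ => (‖w‖ ^ 2) ^ d * Real.exp (-(m * ‖w‖ ^ 2)) := by
  by_contra h
  have h1 := integral_norm_pow_mul_exp hm d
  rw [integral_undef h] at h1
  have : 0 < Real.pi * (d.factorial / m ^ (d + 1)) := by positivity
  linarith

/-- Functions of polynomial growth are integrable against the Gaussian measure. -/
theorem PolyGrowth.integrable {m : ℝ} (hm : 0 < m) {f : ℂ → ℂ} (hf : PolyGrowth f) :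
    Integrable f (fockMeasure m) := by
  obtain ⟨D, d, hD0, hD⟩ := hf.exists_bound
  rw [fockMeasure, integrable_withDensity_iff_integrable_smul' (by fun_prop)
    (Eventually.of_forall fun _ => ENNReal.ofReal_lt_top), normalizedArea]
  refine Integrable.smul_measure ?_ ENNReal.ofReal_ne_top
  have h0 := integrable_norm_pow_mul_exp hm 0
  have h1 := integrable_norm_pow_mul_exp hm d
  refine ((h0.add h1).const_mul (D * 2 ^ (d - 1))).mono'
    ((by fun_prop : Measurable fun w : ℂ =>
      (ENNReal.ofReal (Real.exp (-(m * ‖w‖ ^ 2)))).toReal).aestronglyMeasurable.smul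
      hf.1.aestronglyMeasurable) (Eventually.of_forall fun w => ?_)
  rw [ENNReal.toReal_ofReal (Real.exp_pos _).le, norm_smul, Real.norm_of_nonneg (Real.exp_pos _).le]
  have h2 := add_pow_le (zero_le_one (α := ℝ)) (sq_nonneg ‖w‖) d
  rw [one_pow] at h2
  calc _ ≤ Real.exp (-(m * ‖w‖ ^ 2)) * (D * (2 ^ (d - 1) * (1 + (‖w‖ ^ 2) ^ d))) := by
        gcongr
        exact (hD w).trans (by gcongr)
    _ = _ := by simp only [Pi.add_apply, pow_zero]; ring

theorem PolyGrowth.memLp {m : ℝ} (hm : 0 < m) {f : ℂ → ℂ} (hf : PolyGrowth f) :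
    MemLp f 2 (fockMeasure m) := by
  rw [memLp_two_iff_integrable_sq_norm hf.1.aestronglyMeasurable]
  simpa using ((hf.mul hf.conj).integrable hm).norm.congr
    (Eventually.of_forall fun w => by simp [sq])

/-! ### The inner product and the norm of the weighted space -/

/-- The pairing `⟨f, h⟩ = ∫ f conj(h) exp(-m|w|²) dA`. -/
noncomputable def fockInner (m : ℝ) (f h : ℂ → ℂ) : ℂ :=
  ∫ w, f w * starRingEnd ℂ (h w) ∂fockMeasure m

/-- The norm `‖f‖ = (∫ |f|² exp(-m|w|²) dA)^{1/2}`. -/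
noncomputable def fockNorm (m : ℝ) (f : ℂ → ℂ) : ℝ :=
  √(∫ w, ‖f w‖ ^ 2 ∂fockMeasure m)

theorem fockNorm_nonneg (m : ℝ) (f : ℂ → ℂ) : 0 ≤ fockNorm m f := Real.sqrt_nonneg _

theorem fockNorm_sq (m : ℝ) (f : ℂ → ℂ) : fockNorm m f ^ 2 = ∫ w, ‖f w‖ ^ 2 ∂fockMeasure m :=
  Real.sq_sqrt (integral_nonneg fun _ => by positivity)

theorem fockNorm_congr (m : ℝ) {f g : ℂ → ℂ} (h : ∀ w, ‖f w‖ = ‖g w‖) :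
    fockNorm m f = fockNorm m g := by simp only [fockNorm, h]

theorem fockInner_self (m : ℝ) (f : ℂ → ℂ) : fockInner m f f = (fockNorm m f ^ 2 : ℝ) := by
  rw [fockNorm_sq, ← integral_complex_ofReal, fockInner]
  simp [Complex.mul_conj']

section Hilbert
variable {m : ℝ} {f g h : ℂ → ℂ}

theorem fockInner_eq_inner (hm : 0 < m) (hf : PolyGrowth f) (hg : PolyGrowth g) :
    fockInner m f g = inner ℂ ((hg.memLp hm).toLp g) ((hf.memLp hm).toLp f) := by
  rw [L2.inner_def, fockInner]
  refine integral_congr_ae ?_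
  filter_upwards [(hg.memLp hm).coeFn_toLp, (hf.memLp hm).coeFn_toLp] with w h1 h2
  rw [h1, h2, RCLike.inner_apply]

theorem fockNorm_eq_norm (hm : 0 < m) (hf : PolyGrowth f) :
    fockNorm m f = ‖(hf.memLp hm).toLp f‖ := by
  have h := fockInner_eq_inner hm hf hf
  rw [fockInner_self, inner_self_eq_norm_sq_to_K] at h
  have h2 : fockNorm m f ^ 2 = ‖(hf.memLp hm).toLp f‖ ^ 2 := Complex.ofReal_injective <| by
    rw [h]; simp
  exact (sq_eq_sq₀ (fockNorm_nonneg _ _) (norm_nonneg _)).1 h2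

theorem norm_fockInner_le (hm : 0 < m) (hf : PolyGrowth f) (hg : PolyGrowth g) :
    ‖fockInner m f g‖ ≤ fockNorm m f * fockNorm m g := by
  rw [fockInner_eq_inner hm hf hg, fockNorm_eq_norm hm hf, fockNorm_eq_norm hm hg, mul_comm]
  exact norm_inner_le_norm _ _

theorem fockNorm_add_le (hm : 0 < m) (hf : PolyGrowth f) (hg : PolyGrowth g) :
    fockNorm m (fun w => f w + g w) ≤ fockNorm m f + fockNorm m g := by
  rw [fockNorm_eq_norm hm hf, fockNorm_eq_norm hm hg, fockNorm_eq_norm hm (hf.add hg)]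
  exact norm_add_le ((hf.memLp hm).toLp f) ((hg.memLp hm).toLp g)

theorem fockNorm_sub_le (hm : 0 < m) (hf : PolyGrowth f) (hg : PolyGrowth g) :
    fockNorm m (fun w => f w - g w) ≤ fockNorm m f + fockNorm m g := by
  have := fockNorm_add_le hm hf hg.neg
  simpa [sub_eq_add_neg, fockNorm_congr m (f := fun w => -g w) (g := g)] using this

theorem fockInner_add_left (hm : 0 < m) (hf : PolyGrowth f) (hg : PolyGrowth g)
    (hh : PolyGrowth h) :
    fockInner m (fun w => f w + g w) h = fockInner m f h + fockInner m g h := by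
  simp only [fockInner, add_mul]
  exact integral_add ((hf.mul hh.conj).integrable hm) ((hg.mul hh.conj).integrable hm)

theorem fockInner_const_mul_left (c : ℂ) :
    fockInner m (fun w => c * f w) h = c * fockInner m f h := by
  simp only [fockInner, mul_assoc, integral_const_mul]

theorem fockInner_sub_left (hm : 0 < m) (hf : PolyGrowth f) (hg : PolyGrowth g)
    (hh : PolyGrowth h) :
    fockInner m (fun w => f w - g w) h = fockInner m f h - fockInner m g h := by
  simp only [fockInner, sub_mul]
  exact integral_sub ((hf.mul hh.conj).integrable hm) ((hg.mul hh.conj).integrable hm)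

theorem fockInner_conj_symm : starRingEnd ℂ (fockInner m f g) = fockInner m g f := by
  rw [fockInner, fockInner, ← integral_conj]
  simp [mul_comm]

theorem fockInner_sum_left (hm : 0 < m) {ι : Type*} (s : Finset ι) {F : ι → ℂ → ℂ}
    (hF : ∀ i ∈ s, PolyGrowth (F i)) (hh : PolyGrowth h) :
    fockInner m (fun w => ∑ i ∈ s, F i w) h = ∑ i ∈ s, fockInner m (F i) h := by
  simp only [fockInner, Finset.sum_mul]
  exact integral_finsetSum _ fun i hi => ((hF i hi).mul hh.conj).integrable hm

theorem fockInner_mul_left (p : ℂ → ℂ) :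
    fockInner m (fun w => p w * f w) g = fockInner m f (fun w => starRingEnd ℂ (p w) * g w) := by
  simp only [fockInner, map_mul, Complex.conj_conj]
  congr 1; ext w; ring

end Hilbert

/-- The monomials `conj w ^ k` are orthogonal, with `‖conj w ^ k‖² = k! / m ^ (k + 1)`. -/
theorem fockInner_conj_pow {m : ℝ} (hm : 0 < m) (k l : ℕ) :
    fockInner m (fun w => starRingEnd ℂ w ^ k) (fun w => starRingEnd ℂ w ^ l)
      = if k = l then ((k.factorial / m ^ (k + 1) : ℝ) : ℂ) else 0 := by
  rw [fockInner, integral_fockMeasure, integral_normalizedArea]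
  split_ifs with hkl
  · subst hkl
    have h := integral_norm_pow_mul_exp hm k
    calc _ = Real.pi⁻¹ • ∫ w : ℂ, (((‖w‖ ^ 2) ^ k * Real.exp (-(m * ‖w‖ ^ 2)) : ℝ) : ℂ) := by
          congr 2; ext w
          rw [map_pow, Complex.conj_conj, ← mul_pow, mul_comm, Complex.conj_mul']
          push_cast; ring
      _ = _ := by
          rw [integral_complex_ofReal, h, Complex.real_smul, ← Complex.ofReal_mul]
          congr 1
          field_simp
  · -- The integral is multiplied by `exp(i(l - k)t)` under the rotation by the angle `t`.
    set F : ℂ → ℂ := fun w => starRingEnd ℂ w ^ k * starRingEnd ℂ (starRingEnd ℂ w ^ l) *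
      (Real.exp (-(m * ‖w‖ ^ 2)) : ℂ) with hF
    have hrot : ∀ a : Circle, ∫ w, F w = (starRingEnd ℂ (a : ℂ) ^ k * (a : ℂ) ^ l) * ∫ w, F w := by
      intro a
      have h1 := ((rotation a).measurePreserving).integral_comp
        (rotation a).toHomeomorph.measurableEmbedding F
      rw [← integral_const_mul, ← h1]
      congr 1; ext w
      simp only [hF, rotation_apply, map_mul, norm_mul, Circle.norm_coe, one_mul, mul_pow, map_pow,
        Complex.conj_conj]
      ring
    have hlk : ((l : ℝ) - k) ≠ 0 := sub_ne_zero.2 (by exact_mod_cast Ne.symm hkl)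
    have h2 := hrot (Circle.exp (Real.pi / (l - k)))
    have h3 : starRingEnd ℂ (Circle.exp (Real.pi / (l - k)) : ℂ) ^ k *
        (Circle.exp (Real.pi / (l - k)) : ℂ) ^ l = -1 := by
      rw [Circle.coe_exp, ← Complex.exp_conj, ← Complex.exp_nat_mul, ← Complex.exp_nat_mul,
        ← Complex.exp_add, ← Complex.exp_pi_mul_I]
      congr 1
      have : ((l : ℂ) - k) ≠ 0 := by exact_mod_cast hlk
      simp only [map_mul, Complex.conj_ofReal, Complex.conj_I]
      push_cast
      field_simp
      ring
    rw [h3] at h2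
    have h4 : ∫ w, F w = 0 := by linear_combination h2 / 2
    rw [h4, smul_zero]

/-! ### Complex Hermite polynomials -/

/-- The complex Hermite (Itô) polynomials `H_{j,k}` of the weight `exp(-m|w|²)`, given by
`H_{0,k} = conj w ^ k` and `H_{j+1,k} = w H_{j,k} - (k/m) H_{j,k-1}`. For `k = 0` the last term has
coefficient zero, so that the truncated index `k - 1` is harmless. -/
noncomputable def itoHermite (m : ℝ) : ℕ → ℕ → ℂ → ℂ
  | 0, k => fun w => starRingEnd ℂ w ^ k
  | j + 1, k => fun w => w * itoHermite m j k w - (k / m : ℝ) * itoHermite m j (k - 1) w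

section Hermite
variable {m : ℝ}

theorem itoHermite_zero (k : ℕ) (w : ℂ) : itoHermite m 0 k w = starRingEnd ℂ w ^ k := rfl

theorem itoHermite_succ (j k : ℕ) (w : ℂ) : itoHermite m (j + 1) k w
    = w * itoHermite m j k w - (k / m : ℝ) * itoHermite m j (k - 1) w := rfl

theorem conj_mul_itoHermite (j k : ℕ) (w : ℂ) : starRingEnd ℂ w * itoHermite m j k w
    = itoHermite m j (k + 1) w + (j / m : ℝ) * itoHermite m (j - 1) k w := by
  induction j generalizing k with
  | zero => simp [itoHermite_zero, pow_succ, mul_comm]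
  | succ j ih =>
    have h1 := ih k
    rw [itoHermite_succ, itoHermite_succ]
    rcases k with _ | k
    · simp only [Nat.cast_zero, zero_div, Complex.ofReal_zero, zero_mul, sub_zero, zero_add,
        Nat.add_sub_cancel, Nat.cast_one] at h1 ⊢
      rcases j with _ | j
      · simp only [Nat.cast_zero, zero_div, Complex.ofReal_zero, zero_mul, add_zero] at h1
        push_cast
        linear_combination w * h1
      · simp only [Nat.add_sub_cancel] at h1
        rw [itoHermite_succ j 0] at h1 ⊢
        simp only [Nat.cast_zero, zero_div, Complex.ofReal_zero, zero_mul, sub_zero] at h1 ⊢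
        push_cast at h1 ⊢
        linear_combination w * h1
    · have h2 := ih k
      simp only [Nat.add_sub_cancel]
      rcases j with _ | j
      · simp only [Nat.cast_zero, zero_div, Complex.ofReal_zero, zero_mul, add_zero] at h1 h2
        push_cast
        linear_combination w * h1 - ((k + 1) / m : ℂ) * h2
      · simp only [Nat.add_sub_cancel] at h1 h2
        have h3 := itoHermite_succ (m := m) j (k + 1) w
        simp only [Nat.add_sub_cancel] at h3
        push_cast at h1 h2 h3 ⊢
        linear_combination w * h1 - ((k + 1) / m : ℂ) * h2 - ((j + 1) / m : ℂ) * h3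

theorem polyGrowth_itoHermite (j k : ℕ) : PolyGrowth (itoHermite m j k) := by
  induction j generalizing k with
  | zero => exact PolyGrowth.id.conj.pow k
  | succ j ih => exact (PolyGrowth.id.mul (ih k)).sub ((ih (k - 1)).const_mul _)

/-- Since multiplication by `w` and by `conj w` are adjoint to each other, the two recursions
determine all the pairings of the complex Hermite polynomials. -/
theorem fockInner_itoHermite (hm : 0 < m) (j k a b : ℕ) :
    fockInner m (itoHermite m j k) (itoHermite m a b)
      = if j = a ∧ k = b then ((j.factorial * k.factorial / m ^ (j + k + 1) : ℝ) : ℂ) else 0 := by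
  have hm0 : (m : ℂ) ≠ 0 := by exact_mod_cast hm.ne'
  have hG := polyGrowth_itoHermite (m := m)
  -- moving a factor `w` from the left to the right
  have hmove : ∀ j k a b, fockInner m (itoHermite m (j + 1) k) (itoHermite m a b)
      = fockInner m (itoHermite m j k) (itoHermite m a (b + 1))
        + (a / m : ℝ) * fockInner m (itoHermite m j k) (itoHermite m (a - 1) b)
        - (k / m : ℝ) * fockInner m (itoHermite m j (k - 1)) (itoHermite m a b) := by
    intro j k a b
    have h1 : itoHermite m (j + 1) k
        = fun w => w * itoHermite m j k w - (k / m : ℝ) * itoHermite m j (k - 1) w := rfl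
    rw [h1, fockInner_sub_left hm (PolyGrowth.id.mul (hG _ _)) ((hG _ _).const_mul _) (hG _ _),
      fockInner_const_mul_left, fockInner_mul_left (m := m) (fun w => w)]
    simp only [conj_mul_itoHermite]
    rw [← fockInner_conj_symm, fockInner_add_left hm (hG _ _) ((hG _ _).const_mul _) (hG _ _),
      fockInner_const_mul_left, map_add, map_mul, Complex.conj_ofReal, fockInner_conj_symm,
      fockInner_conj_symm]
  have hbase : ∀ a k b, fockInner m (itoHermite m 0 k) (itoHermite m a b)
      = if 0 = a ∧ k = b then ((k.factorial / m ^ (k + 1) : ℝ) : ℂ) else 0 := by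
    intro a
    induction a with
    | zero =>
      intro k b
      have h := fockInner_conj_pow hm k b
      simp only [true_and]
      exact h
    | succ a ih =>
      intro k b
      have h1 := hmove a b 0 k
      rw [if_neg (by simp)]
      rw [← fockInner_conj_symm, h1]
      simp only [Nat.cast_zero, zero_div, Complex.ofReal_zero, zero_mul, add_zero, map_sub, map_mul,
        Complex.conj_ofReal, fockInner_conj_symm, ih]
      rcases b with _ | b
      · simp
      · simp only [Nat.add_right_cancel_iff, Nat.add_sub_cancel]
        split_ifs with h
        · rw [← h.2, Nat.factorial_succ]
          push_cast
          field_simp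
          ring
        · simp
  induction j generalizing k a b with
  | zero => simpa using hbase a k b
  | succ j ih =>
    rw [hmove, ih, ih, ih]
    rcases a with _ | a <;> rcases k with _ | k
    · simp
    · simp only [Nat.add_right_cancel_iff, Nat.add_sub_cancel, Nat.cast_zero, zero_div,
        Complex.ofReal_zero, zero_mul, add_zero]
      rw [if_neg (by simp : ¬ (j + 1 = 0 ∧ k + 1 = b))]
      split_ifs with h
      · rw [Nat.factorial_succ]
        push_cast
        field_simp
        ring
      · simp
    · simp only [Nat.add_right_cancel_iff, Nat.add_sub_cancel, Nat.cast_zero, zero_div,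
        Complex.ofReal_zero, zero_mul, sub_zero]
      rw [if_neg (by simp)]
      split_ifs with h
      · rw [h.1, Nat.factorial_succ]
        push_cast
        field_simp
        ring
      · simp
    · simp only [Nat.add_right_cancel_iff, Nat.add_sub_cancel]
      by_cases h1 : j = a + 1 ∧ k = b
      · have h2 : ¬ (j = a ∧ k + 1 = b) := by omega
        rw [if_pos h1, if_neg h2, if_neg h2, if_pos h1, Nat.factorial_succ k]
        push_cast
        field_simp
        ring
      · rw [if_neg h1, if_neg h1]
        split_ifs with h2
        · rw [← h2.1, Nat.factorial_succ j]
          push_cast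
          field_simp
          ring
        · simp

theorem polyanalyticPol_mono {n n' q q' : ℕ} (hn : n ≤ n') (hq : q ≤ q') :
    polyanalyticPol n q ≤ polyanalyticPol n' q' := by
  refine Submodule.span_mono ?_
  rintro f ⟨j, k, hj, hk, rfl⟩
  exact ⟨j, k, hj.trans_le hn, hk.trans_le hq, rfl⟩

theorem mul_mem_polyanalyticPol {n q : ℕ} {f : ℂ → ℂ} (hf : f ∈ polyanalyticPol n q) :
    (fun w => w * f w) ∈ polyanalyticPol (n + 1) q := by
  induction hf using Submodule.span_induction with
  | mem g hg =>
    obtain ⟨j, k, hj, hk, rfl⟩ := hg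
    exact Submodule.subset_span ⟨j + 1, k, by omega, hk, by ext w; ring⟩
  | zero =>
    convert Submodule.zero_mem _
    simp
  | add g h _ _ hg hh =>
    convert Submodule.add_mem _ hg hh using 1
    ext w; simp [mul_add]
  | smul c g _ hg =>
    convert Submodule.smul_mem _ c hg using 1
    ext w; simp [mul_left_comm]

theorem conj_mul_mem_polyanalyticPol {n q : ℕ} {f : ℂ → ℂ} (hf : f ∈ polyanalyticPol n q) :
    (fun w => starRingEnd ℂ w * f w) ∈ polyanalyticPol n (q + 1) := by
  induction hf using Submodule.span_induction with
  | mem g hg =>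
    obtain ⟨j, k, hj, hk, rfl⟩ := hg
    exact Submodule.subset_span ⟨j, k + 1, hj, by omega, by ext w; ring⟩
  | zero =>
    convert Submodule.zero_mem _
    simp
  | add g h _ _ hg hh =>
    convert Submodule.add_mem _ hg hh using 1
    ext w; simp [mul_add]
  | smul c g _ hg =>
    convert Submodule.smul_mem _ c hg using 1
    ext w; simp [mul_left_comm]

theorem pow_mul_mem_polyanalyticPol {n q : ℕ} {f : ℂ → ℂ} (hf : f ∈ polyanalyticPol n q) (s : ℕ) :
    (fun w => w ^ s * f w) ∈ polyanalyticPol (n + s) q := by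
  induction s with
  | zero => simpa using hf
  | succ s ih =>
    simp only [pow_succ', mul_assoc]
    exact mul_mem_polyanalyticPol ih

theorem polyGrowth_of_mem {n q : ℕ} {f : ℂ → ℂ} (hf : f ∈ polyanalyticPol n q) :
    PolyGrowth f := by
  induction hf using Submodule.span_induction with
  | mem g hg =>
    obtain ⟨j, k, -, -, rfl⟩ := hg
    exact (PolyGrowth.id.pow j).mul (PolyGrowth.id.conj.pow k)
  | zero => exact PolyGrowth.const 0
  | add g h _ _ hg hh => exact hg.add hh
  | smul c g _ hg => exact hg.const_mul c

theorem itoHermite_mem (m : ℝ) (j k : ℕ) : itoHermite m j k ∈ polyanalyticPol (j + 1) (k + 1) := by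
  induction j generalizing k with
  | zero => exact Submodule.subset_span ⟨0, k, by simp, by simp, by ext w; simp [itoHermite_zero]⟩
  | succ j ih =>
    exact Submodule.sub_mem _ (mul_mem_polyanalyticPol (ih k))
      (Submodule.smul_mem _ _ (polyanalyticPol_mono (by omega) (by omega) (ih (k - 1))))

/-- The space `Pol_{n,q}` is spanned by the complex Hermite polynomials. -/
theorem polyanalyticPol_eq_span_itoHermite (m : ℝ) (n q : ℕ) :
    polyanalyticPol n q
      = Submodule.span ℂ {f | ∃ j k : ℕ, j < n ∧ k < q ∧ f = itoHermite m j k} := by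
  apply le_antisymm
  · refine Submodule.span_le.2 ?_
    rintro f ⟨j, k, hj, hk, rfl⟩
    have key : ∀ j k : ℕ, (fun z : ℂ => z ^ j * starRingEnd ℂ z ^ k) ∈
        Submodule.span ℂ {f | ∃ a b : ℕ, a < j + 1 ∧ b < k + 1 ∧ f = itoHermite m a b} := by
      intro j k
      induction j with
      | zero =>
        refine Submodule.subset_span ⟨0, k, by simp, by simp, ?_⟩
        ext w; simp [itoHermite_zero]
      | succ j ih =>
        have hmul : ∀ g ∈ Submodule.span ℂ
            {f | ∃ a b : ℕ, a < j + 1 ∧ b < k + 1 ∧ f = itoHermite m a b},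
            (fun w => w * g w) ∈ Submodule.span ℂ
              {f | ∃ a b : ℕ, a < j + 1 + 1 ∧ b < k + 1 ∧ f = itoHermite m a b} := by
          intro g hg
          induction hg using Submodule.span_induction with
          | mem g hg =>
            obtain ⟨a, b, ha, hb, rfl⟩ := hg
            have h1 : (fun w => w * itoHermite m a b w)
                = itoHermite m (a + 1) b + ((b / m : ℝ) : ℂ) • itoHermite m a (b - 1) := by
              ext w
              simp only [Pi.add_apply, Pi.smul_apply, smul_eq_mul, itoHermite_succ]
              ring
            rw [h1]
            exact Submodule.add_mem _
              (Submodule.subset_span ⟨a + 1, b, by omega, hb, rfl⟩)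
              (Submodule.smul_mem _ _ (Submodule.subset_span ⟨a, b - 1, by omega, by omega, rfl⟩))
          | zero =>
            convert Submodule.zero_mem _
            simp
          | add g h _ _ hg hh =>
            convert Submodule.add_mem _ hg hh using 1
            ext w; simp [mul_add]
          | smul c g _ hg =>
            convert Submodule.smul_mem _ c hg using 1
            ext w; simp [mul_left_comm]
        convert hmul _ ih using 1
        ext w; ring
    refine Submodule.span_mono ?_ (key j k)
    rintro f ⟨a, b, ha, hb, rfl⟩
    exact ⟨a, b, by omega, by omega, rfl⟩
  · refine Submodule.span_le.2 ?_
    rintro f ⟨j, k, hj, hk, rfl⟩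
    exact polyanalyticPol_mono (by omega) (by omega) (itoHermite_mem m j k)

end Hermite

/-! ### The orthonormal basis -/

/-- The normalized complex Hermite polynomials `e_{j,k}`, an orthonormal system in
`L²(exp(-m|w|²) dA)`. -/
noncomputable def fockBasis (m : ℝ) (i : ℕ × ℕ) : ℂ → ℂ :=
  fun w => (√(m ^ (i.1 + i.2 + 1) / (i.1.factorial * i.2.factorial)) : ℂ) *
    itoHermite m i.1 i.2 w

section Basis
variable {m : ℝ}

theorem polyGrowth_fockBasis (i : ℕ × ℕ) : PolyGrowth (fockBasis m i) :=
  (polyGrowth_itoHermite _ _).const_mul _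

theorem fockInner_fockBasis (hm : 0 < m) (i l : ℕ × ℕ) :
    fockInner m (fockBasis m i) (fockBasis m l) = if i = l then 1 else 0 := by
  unfold fockBasis
  rw [fockInner_const_mul_left, ← fockInner_conj_symm, fockInner_const_mul_left, map_mul,
    Complex.conj_ofReal, fockInner_conj_symm, fockInner_itoHermite hm]
  by_cases h : i = l
  · subst h
    rw [if_pos ⟨rfl, rfl⟩, if_pos rfl]
    norm_cast
    rw [← mul_assoc, Real.mul_self_sqrt (by positivity)]
    field_simp
  · rw [if_neg (fun h' => h (Prod.ext h'.1 h'.2)), if_neg h, mul_zero, mul_zero]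

theorem mul_fockBasis (hm : 0 < m) (j k : ℕ) (w : ℂ) : w * fockBasis m (j, k) w
    = (√((j + 1) / m) : ℂ) * fockBasis m (j + 1, k) w
      + (√(k / m) : ℂ) * fockBasis m (j, k - 1) w := by
  have h1 : √(m ^ (j + k + 1) / (j.factorial * k.factorial))
      = √((j + 1) / m) * √(m ^ (j + 1 + k + 1) / ((j + 1).factorial * k.factorial)) := by
    rw [← Real.sqrt_mul (by positivity), Nat.factorial_succ]
    congr 1
    push_cast
    field_simp
    ring
  have h2 : √(m ^ (j + k + 1) / (j.factorial * k.factorial)) * (k / m)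
      = √(k / m) * √(m ^ (j + (k - 1) + 1) / (j.factorial * (k - 1).factorial)) := by
    rcases k with _ | k
    · simp
    · rw [← Real.sqrt_mul (by positivity), Nat.factorial_succ, Nat.add_sub_cancel]
      rw [← Real.sqrt_sq (show 0 ≤ ((k + 1 : ℕ) : ℝ) / m by positivity),
        ← Real.sqrt_mul (by positivity),
        Real.sqrt_sq (show 0 ≤ ((k + 1 : ℕ) : ℝ) / m by positivity)]
      congr 1
      push_cast
      field_simp
      ring
  have h3 := itoHermite_succ (m := m) j k w
  have h1' : (√(m ^ (j + k + 1) / (j.factorial * k.factorial)) : ℂ)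
      = (√((j + 1) / m) : ℂ) *
        (√(m ^ (j + 1 + k + 1) / ((j + 1).factorial * k.factorial)) : ℂ) := by
    exact_mod_cast h1
  have h2' : (√(m ^ (j + k + 1) / (j.factorial * k.factorial)) : ℂ) * (k / m : ℝ)
      = (√(k / m) : ℂ) * (√(m ^ (j + (k - 1) + 1) / (j.factorial * (k - 1).factorial)) : ℂ) := by
    exact_mod_cast h2
  simp only [fockBasis]
  linear_combination (itoHermite m (j + 1) k w) * h1' + (itoHermite m j (k - 1) w) * h2'
    - (√(m ^ (j + k + 1) / (j.factorial * k.factorial)) : ℂ) * h3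

theorem conj_mul_fockBasis (hm : 0 < m) (j k : ℕ) (w : ℂ) :
    starRingEnd ℂ w * fockBasis m (j, k) w
      = (√((k + 1) / m) : ℂ) * fockBasis m (j, k + 1) w
        + (√(j / m) : ℂ) * fockBasis m (j - 1, k) w := by
  have h1 : √(m ^ (j + k + 1) / (j.factorial * k.factorial))
      = √((k + 1) / m) * √(m ^ (j + (k + 1) + 1) / (j.factorial * (k + 1).factorial)) := by
    rw [← Real.sqrt_mul (by positivity), Nat.factorial_succ]
    congr 1
    push_cast
    field_simp
    ring
  have h2 : √(m ^ (j + k + 1) / (j.factorial * k.factorial)) * (j / m)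
      = √(j / m) * √(m ^ (j - 1 + k + 1) / ((j - 1).factorial * k.factorial)) := by
    rcases j with _ | j
    · simp
    · rw [← Real.sqrt_mul (by positivity), Nat.factorial_succ, Nat.add_sub_cancel]
      rw [← Real.sqrt_sq (show 0 ≤ ((j + 1 : ℕ) : ℝ) / m by positivity),
        ← Real.sqrt_mul (by positivity),
        Real.sqrt_sq (show 0 ≤ ((j + 1 : ℕ) : ℝ) / m by positivity)]
      congr 1
      push_cast
      field_simp
      ring
  have h3 := conj_mul_itoHermite (m := m) j k w
  have h1' : (√(m ^ (j + k + 1) / (j.factorial * k.factorial)) : ℂ)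
      = (√((k + 1) / m) : ℂ) *
        (√(m ^ (j + (k + 1) + 1) / (j.factorial * (k + 1).factorial)) : ℂ) := by
    exact_mod_cast h1
  have h2' : (√(m ^ (j + k + 1) / (j.factorial * k.factorial)) : ℂ) * (j / m : ℝ)
      = (√(j / m) : ℂ) * (√(m ^ (j - 1 + k + 1) / ((j - 1).factorial * k.factorial)) : ℂ) := by
    exact_mod_cast h2
  simp only [fockBasis]
  linear_combination (itoHermite m j (k + 1) w) * h1' + (itoHermite m (j - 1) k w) * h2'
    + (√(m ^ (j + k + 1) / (j.factorial * k.factorial)) : ℂ) * h3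

theorem fockBasis_mem {n q : ℕ} {i : ℕ × ℕ} (hi : i ∈ Finset.range n ×ˢ Finset.range q) :
    fockBasis m i ∈ polyanalyticPol n q := by
  simp only [Finset.mem_product, Finset.mem_range] at hi
  exact Submodule.smul_mem _ _ (polyanalyticPol_mono (by omega) (by omega) (itoHermite_mem m _ _))

theorem sum_fockBasis_mem {n q : ℕ} (c : ℕ × ℕ → ℂ) :
    (fun w => ∑ i ∈ Finset.range n ×ˢ Finset.range q, c i * fockBasis m i w)
      ∈ polyanalyticPol n q := by
  convert Submodule.sum_mem (polyanalyticPol n q) (t := Finset.range n ×ˢ Finset.range q)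
    (f := fun i => c i • fockBasis m i) (fun i hi => Submodule.smul_mem _ _ (fockBasis_mem hi))
  simp

/-- Pairing an expansion in the orthonormal system with another one. -/
theorem fockInner_sum_sum (hm : 0 < m) {ι : Type*} (S : Finset ι) (σ : ι → ℕ × ℕ)
    (hσ : Set.InjOn σ S) (c d : ι → ℂ) :
    fockInner m (fun w => ∑ i ∈ S, c i * fockBasis m (σ i) w)
      (fun w => ∑ i ∈ S, d i * fockBasis m (σ i) w) = ∑ i ∈ S, c i * starRingEnd ℂ (d i) := by
  have hG := fun i => polyGrowth_fockBasis (m := m) (σ i)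
  rw [fockInner_sum_left hm S (fun i _ => (hG i).const_mul _)
    (PolyGrowth.sum S fun i _ => (hG i).const_mul _)]
  refine Finset.sum_congr rfl fun i hi => ?_
  rw [fockInner_const_mul_left, ← fockInner_conj_symm,
    fockInner_sum_left hm S (fun i _ => (hG i).const_mul _) (hG i), Finset.sum_eq_single i]
  · rw [fockInner_const_mul_left, fockInner_fockBasis hm, if_pos rfl, mul_one]
  · intro l hl hli
    rw [fockInner_const_mul_left, fockInner_fockBasis hm,
      if_neg (fun h => hli (hσ hl hi h)), mul_zero]
  · exact fun h => absurd hi h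

theorem fockNorm_sum_sq (hm : 0 < m) {ι : Type*} (S : Finset ι) (σ : ι → ℕ × ℕ)
    (hσ : Set.InjOn σ S) (c : ι → ℂ) :
    fockNorm m (fun w => ∑ i ∈ S, c i * fockBasis m (σ i) w) ^ 2 = ∑ i ∈ S, ‖c i‖ ^ 2 := by
  have h := fockInner_sum_sum hm S σ hσ c c
  rw [fockInner_self] at h
  simp only [Complex.mul_conj'] at h
  exact_mod_cast h

/-- A weighted shift of the orthonormal system is bounded by the supremum of its weights. -/
theorem fockNorm_weighted_shift_le (hm : 0 < m) (S : Finset (ℕ × ℕ)) (σ : ℕ × ℕ → ℕ × ℕ)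
    (c : ℕ × ℕ → ℂ) (a : ℕ × ℕ → ℝ) {B : ℝ} (hB : 0 ≤ B)
    (hσ : Set.InjOn σ {i | i ∈ S ∧ a i ≠ 0}) (ha : ∀ i ∈ S, |a i| ≤ B) :
    fockNorm m (fun w => ∑ i ∈ S, c i * (a i * fockBasis m (σ i) w))
      ≤ B * fockNorm m (fun w => ∑ i ∈ S, c i * fockBasis m i w) := by
  refine le_of_sq_le_sq ?_ (mul_nonneg hB (fockNorm_nonneg _ _))
  have h1 : (fun w => ∑ i ∈ S, c i * (a i * fockBasis m (σ i) w))
      = fun w => ∑ i ∈ S with a i ≠ 0, (c i * a i) * fockBasis m (σ i) w := by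
    ext w
    rw [Finset.sum_filter]
    refine Finset.sum_congr rfl fun i _ => ?_
    split_ifs with h
    · ring
    · rw [not_not.1 h]; simp
  rw [h1, fockNorm_sum_sq hm _ σ (by simpa [Set.InjOn] using hσ), mul_pow,
    fockNorm_sum_sq hm S (fun i => i) (fun _ _ _ _ h => h), Finset.mul_sum]
  refine (Finset.sum_le_sum_of_subset_of_nonneg (Finset.filter_subset _ _)
    fun _ _ _ => by positivity).trans (Finset.sum_le_sum fun i hi => ?_)
  rw [norm_mul, mul_pow, mul_comm, Complex.norm_real]
  gcongr
  exact ha i hi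

/-- Every element of `Pol_{n,q}` is the sum of its orthogonal expansion. -/
theorem eq_sum_of_mem (hm : 0 < m) {n q : ℕ} {f : ℂ → ℂ} (hf : f ∈ polyanalyticPol n q) :
    f = fun w => ∑ i ∈ Finset.range n ×ˢ Finset.range q,
      fockInner m f (fockBasis m i) * fockBasis m i w := by
  have hS : ∀ g ∈ polyanalyticPol n q, PolyGrowth g := fun g hg => polyGrowth_of_mem hg
  -- both sides are linear in `f`, so it is enough to check the spanning Hermite polynomials
  rw [polyanalyticPol_eq_span_itoHermite m] at hf
  induction hf using Submodule.span_induction with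
  | mem g hg =>
    obtain ⟨j, k, hj, hk, rfl⟩ := hg
    have hmem : (j, k) ∈ Finset.range n ×ˢ Finset.range q := by simp [hj, hk]
    set C : ℝ := √(m ^ (j + k + 1) / (j.factorial * k.factorial)) with hC
    have hC0 : (C : ℂ) ≠ 0 := by
      have : 0 < C := by positivity
      exact_mod_cast this.ne'
    have h1 : itoHermite m j k = fun w => (C : ℂ)⁻¹ * fockBasis m (j, k) w := by
      ext w
      simp only [fockBasis, ← hC]
      field_simp
    ext w
    rw [Finset.sum_eq_single (j, k)]
    · rw [h1, fockInner_const_mul_left, fockInner_fockBasis hm, if_pos rfl, mul_one]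
    · intro l _ hl
      rw [h1, fockInner_const_mul_left, fockInner_fockBasis hm, if_neg (Ne.symm hl)]
      simp
    · exact fun h => absurd hmem h
  | zero => ext w; simp [fockInner]
  | add g h hg' hh' hg hh =>
    rw [← polyanalyticPol_eq_span_itoHermite m] at hg' hh'
    ext w
    have h1 : g + h = fun w => g w + h w := rfl
    simp only [h1, fockInner_add_left hm (hS g hg') (hS h hh') (polyGrowth_fockBasis _), add_mul,
      Finset.sum_add_distrib]
    exact congr_arg₂ (· + ·) (congr_fun hg w) (congr_fun hh w)
  | smul c g _ hg =>
    ext w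
    have h1 : c • g = fun w => c * g w := rfl
    simp only [h1, fockInner_const_mul_left, mul_assoc, ← Finset.mul_sum]
    exact congr_arg (c * ·) (congr_fun hg w)

end Basis

/-! ### Multiplication by `w`, by `conj w` and by `|w|² - 1` -/

section Multiplication
variable {m : ℝ}

/-- Multiplication by `w` on `Pol_{n,q}` has norm at most `√(n/m) + √(q/m)`. -/
theorem fockNorm_mul_le (hm : 0 < m) {n q : ℕ} {f : ℂ → ℂ} (hf : f ∈ polyanalyticPol n q) :
    fockNorm m (fun w => w * f w) ≤ (√(n / m) + √(q / m)) * fockNorm m f := by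
  have hf' := eq_sum_of_mem hm hf
  set c : ℕ × ℕ → ℂ := fun i => fockInner m f (fockBasis m i)
  set S := Finset.range n ×ˢ Finset.range q with hS
  have hG := polyGrowth_fockBasis (m := m)
  have h1 := fockNorm_weighted_shift_le hm S (fun i => (i.1 + 1, i.2)) c
    (fun i => √((i.1 + 1) / m)) (B := √(n / m)) (by positivity)
    (fun i _ l _ h => by simp only [Prod.mk.injEq] at h; exact Prod.ext (by omega) h.2)
    (fun i hi => by
      simp only [hS, Finset.mem_product, Finset.mem_range] at hi
      rw [abs_of_nonneg (by positivity)]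
      gcongr
      exact_mod_cast hi.1)
  have h2 := fockNorm_weighted_shift_le hm S (fun i => (i.1, i.2 - 1)) c
    (fun i => √(i.2 / m)) (B := √(q / m)) (by positivity)
    (fun i hi l hl h => by
      have hi0 : i.2 ≠ 0 := fun h0 => hi.2 (by simp [h0])
      have hl0 : l.2 ≠ 0 := fun h0 => hl.2 (by simp [h0])
      simp only [Prod.mk.injEq] at h
      exact Prod.ext h.1 (by omega))
    (fun i hi => by
      simp only [hS, Finset.mem_product, Finset.mem_range] at hi
      rw [abs_of_nonneg (by positivity)]
      gcongr
      exact_mod_cast hi.2.le)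
  rw [← hf'] at h1 h2
  have h3 : (fun w => w * f w) = fun w => (∑ i ∈ S, c i * ((√((i.1 + 1) / m) : ℝ) *
      fockBasis m (i.1 + 1, i.2) w)) + ∑ i ∈ S, c i * ((√(i.2 / m) : ℝ) *
      fockBasis m (i.1, i.2 - 1) w) := by
    ext w
    conv_lhs => rw [hf']
    simp only [Finset.mul_sum, ← Finset.sum_add_distrib]
    refine Finset.sum_congr rfl fun i _ => ?_
    linear_combination (c i) * mul_fockBasis hm i.1 i.2 w
  rw [h3, add_mul]
  exact (fockNorm_add_le hm (PolyGrowth.sum S fun i _ => ((hG _).const_mul _).const_mul _)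
    (PolyGrowth.sum S fun i _ => ((hG _).const_mul _).const_mul _)).trans (add_le_add h1 h2)

theorem fockNorm_pow_mul_le (hm : 0 < m) {n q : ℕ} {f : ℂ → ℂ} (hf : f ∈ polyanalyticPol n q)
    {B : ℝ} (s : ℕ) (hB : √((n + s : ℕ) / m) + √(q / m) ≤ B) :
    fockNorm m (fun w => w ^ s * f w) ≤ B ^ s * fockNorm m f := by
  have hB0 : 0 ≤ B := le_trans (by positivity) hB
  induction s with
  | zero => simp
  | succ s ih =>
    have hle : √((n + s : ℕ) / m) + √(q / m) ≤ B := by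
      refine le_trans ?_ hB
      gcongr
      exact Nat.le_succ s
    have h1 := fockNorm_mul_le hm (pow_mul_mem_polyanalyticPol hf s)
    have h2 : (fun w => w ^ (s + 1) * f w) = fun w => w * (w ^ s * f w) := by ext w; ring
    rw [h2]
    calc _ ≤ _ := h1
      _ ≤ B * (B ^ s * fockNorm m f) := mul_le_mul hle (ih hle) (fockNorm_nonneg _ _) hB0
      _ = _ := by ring

/-- Up to an error of order `√(q/m)`, multiplication by `conj w` maps `Pol_{n+1,q}` to
`Pol_{n,q}`. -/
theorem exists_fockNorm_conj_mul_sub_le (hm : 0 < m) {n q : ℕ} {f : ℂ → ℂ}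
    (hf : f ∈ polyanalyticPol (n + 1) q) :
    ∃ φ ∈ polyanalyticPol n q,
      fockNorm m (fun w => starRingEnd ℂ w * f w - φ w) ≤ √(q / m) * fockNorm m f ∧
      fockNorm m φ ≤ √((n + 1 : ℕ) / m) * fockNorm m f := by
  have hf' := eq_sum_of_mem hm hf
  set c : ℕ × ℕ → ℂ := fun i => fockInner m f (fockBasis m i)
  set S := Finset.range (n + 1) ×ˢ Finset.range q with hS
  have h1 := fockNorm_weighted_shift_le hm S (fun i => (i.1, i.2 + 1)) c
    (fun i => √((i.2 + 1) / m)) (B := √(q / m)) (by positivity)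
    (fun i _ l _ h => by simp only [Prod.mk.injEq] at h; exact Prod.ext h.1 (by omega))
    (fun i hi => by
      simp only [hS, Finset.mem_product, Finset.mem_range] at hi
      rw [abs_of_nonneg (by positivity)]
      gcongr
      exact_mod_cast hi.2)
  have h2 := fockNorm_weighted_shift_le hm S (fun i => (i.1 - 1, i.2)) c
    (fun i => √(i.1 / m)) (B := √((n + 1 : ℕ) / m)) (by positivity)
    (fun i hi l hl h => by
      have hi0 : i.1 ≠ 0 := fun h0 => hi.2 (by simp [h0])
      have hl0 : l.1 ≠ 0 := fun h0 => hl.2 (by simp [h0])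
      simp only [Prod.mk.injEq] at h
      exact Prod.ext (by omega) h.2)
    (fun i hi => by
      simp only [hS, Finset.mem_product, Finset.mem_range] at hi
      rw [abs_of_nonneg (by positivity)]
      gcongr
      exact hi.1.le)
  rw [← hf'] at h1 h2
  refine ⟨_, ?_, ?_, h2⟩
  · have : (fun w => ∑ i ∈ S, c i * ((√(i.1 / m) : ℝ) * fockBasis m (i.1 - 1, i.2) w))
        = ∑ i ∈ S, (c i * (√(i.1 / m) : ℝ)) • fockBasis m (i.1 - 1, i.2) := by
      ext w; simp [mul_assoc]
    rw [this]
    refine Submodule.sum_mem _ fun i hi => ?_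
    simp only [hS, Finset.mem_product, Finset.mem_range] at hi
    by_cases h0 : i.1 = 0
    · simp [h0]
    · refine Submodule.smul_mem _ _ (fockBasis_mem ?_)
      simp only [Finset.mem_product, Finset.mem_range]
      omega
  · refine le_of_eq_of_le (fockNorm_congr m fun w => ?_) h1
    congr 1
    rw [sub_eq_iff_eq_add]
    conv_lhs => rw [hf']
    simp only [Finset.mul_sum, ← Finset.sum_add_distrib]
    refine Finset.sum_congr rfl fun i _ => ?_
    linear_combination (c i) * conj_mul_fockBasis hm i.1 i.2 w

/-- Multiplication by `|w|² - 1` is small on the span of the `e_{j,k}` with `j + k` close to `m`. -/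
theorem fockNorm_sq_sub_one_mul_le (hm : 0 < m) (S : Finset (ℕ × ℕ)) (c : ℕ × ℕ → ℂ) {η : ℝ}
    (h1 : ∀ i ∈ S, |((i.1 + i.2 + 1 : ℝ) / m) - 1| ≤ η)
    (h2 : ∀ i ∈ S, √((i.2 + 1) / m) * √((i.1 + 1) / m) ≤ η) (hη : 0 ≤ η) :
    fockNorm m (fun w => ((‖w‖ ^ 2 - 1 : ℝ) : ℂ) * ∑ i ∈ S, c i * fockBasis m i w)
      ≤ 3 * η * fockNorm m (fun w => ∑ i ∈ S, c i * fockBasis m i w) := by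
  have hG := polyGrowth_fockBasis (m := m)
  have e1 := fockNorm_weighted_shift_le hm S (fun i => i) c
    (fun i => (i.1 + i.2 + 1 : ℝ) / m - 1) hη (fun i _ l _ h => h) h1
  have e2 := fockNorm_weighted_shift_le hm S (fun i => (i.1 + 1, i.2 + 1)) c
    (fun i => √((i.2 + 1) / m) * √((i.1 + 1) / m)) hη
    (fun i _ l _ h => by
      simp only [Prod.mk.injEq] at h; exact Prod.ext (by omega) (by omega))
    (fun i hi => by rw [abs_of_nonneg (by positivity)]; exact h2 i hi)
  have e3 := fockNorm_weighted_shift_le hm S (fun i => (i.1 - 1, i.2 - 1)) c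
    (fun i => √(i.2 / m) * √(i.1 / m)) hη
    (fun i hi l hl h => by
      have hi1 : i.1 ≠ 0 := fun h0 => hi.2 (by simp [h0])
      have hl1 : l.1 ≠ 0 := fun h0 => hl.2 (by simp [h0])
      have hi2 : i.2 ≠ 0 := fun h0 => hi.2 (by simp [h0])
      have hl2 : l.2 ≠ 0 := fun h0 => hl.2 (by simp [h0])
      simp only [Prod.mk.injEq] at h
      exact Prod.ext (by omega) (by omega))
    (fun i hi => by
      rw [abs_of_nonneg (by positivity)]
      refine le_trans ?_ (h2 i hi)
      gcongr <;> linarith)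
  have hG' : ∀ (a : ℕ × ℕ → ℂ) (σ : ℕ × ℕ → ℕ × ℕ),
      PolyGrowth fun w => ∑ i ∈ S, c i * (a i * fockBasis m (σ i) w) := fun a σ =>
    PolyGrowth.sum S fun i _ => ((hG _).const_mul _).const_mul _
  have h3 : (fun w => ((‖w‖ ^ 2 - 1 : ℝ) : ℂ) * ∑ i ∈ S, c i * fockBasis m i w)
      = fun w => ((∑ i ∈ S, c i * ((((i.1 + i.2 + 1 : ℝ) / m - 1 : ℝ) : ℂ) * fockBasis m i w))
        + ∑ i ∈ S, c i * (((√((i.2 + 1) / m) * √((i.1 + 1) / m) : ℝ) : ℂ) *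
          fockBasis m (i.1 + 1, i.2 + 1) w))
        + ∑ i ∈ S, c i * (((√(i.2 / m) * √(i.1 / m) : ℝ) : ℂ) *
          fockBasis m (i.1 - 1, i.2 - 1) w) := by
    ext w
    simp only [Finset.mul_sum, ← Finset.sum_add_distrib]
    refine Finset.sum_congr rfl fun i _ => ?_
    obtain ⟨j, k⟩ := i
    have hw : ((‖w‖ ^ 2 - 1 : ℝ) : ℂ) = w * starRingEnd ℂ w - 1 := by
      rw [Complex.mul_conj']; push_cast; ring
    have q1 := conj_mul_fockBasis hm j k w
    have q2 := mul_fockBasis hm j (k + 1) w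
    have q3 := mul_fockBasis hm (j - 1) k w
    have r1 : (√((k + 1) / m) : ℂ) * (√((k + 1) / m) : ℂ) = (k + 1) / m := by
      rw [← Complex.ofReal_mul, Real.mul_self_sqrt (by positivity)]; push_cast; ring
    have r2 : (√(j / m) : ℂ) * (√(j / m) : ℂ) = j / m := by
      rw [← Complex.ofReal_mul, Real.mul_self_sqrt (by positivity)]; push_cast; ring
    have q3' : (√(j / m) : ℂ) * (w * fockBasis m (j - 1, k) w)
        = (j / m : ℂ) * fockBasis m (j, k) w
          + (√(j / m) : ℂ) * (√(k / m) : ℂ) * fockBasis m (j - 1, k - 1) w := by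
      rcases j with _ | j
      · simp
      · simp only [Nat.add_sub_cancel] at q3 ⊢
        rw [q3, ← r2]
        push_cast
        ring
    rw [hw]
    simp only [Nat.add_sub_cancel] at q2
    push_cast at q2 ⊢
    linear_combination (c (j, k)) * (w * q1 + (√((k + 1) / m) : ℂ) * q2 + q3'
      + fockBasis m (j, k) w * r1)
  rw [h3]
  calc _ ≤ _ := fockNorm_add_le hm ((hG' _ _).add (hG' _ _)) (hG' _ _)
    _ ≤ _ := add_le_add_left (fockNorm_add_le hm (hG' _ _) (hG' _ _)) _
    _ ≤ _ := add_le_add (add_le_add e1 e2) e3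
    _ = _ := by ring

end Multiplication

/-! ### The reproducing kernel and the Berezin state -/

section Kernel
variable {m : ℝ}

theorem isReproducingKernel_sum (hm : 0 < m) (n q : ℕ) :
    IsReproducingKernel m (polyanalyticPol n q) fun z w =>
      ∑ i ∈ Finset.range n ×ˢ Finset.range q, starRingEnd ℂ (fockBasis m i w) * fockBasis m i z := by
  refine fun w => ⟨sum_fockBasis_mem _, fun f hf => ?_⟩
  have hG := polyGrowth_fockBasis (m := m)
  rw [← integral_fockMeasure]
  change f w = fockInner m f _
  rw [← fockInner_conj_symm, fockInner_sum_left hm _ (fun i _ => (hG i).const_mul _)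
    (polyGrowth_of_mem hf), map_sum]
  conv_lhs => rw [eq_sum_of_mem hm hf]
  refine Finset.sum_congr rfl fun i _ => ?_
  rw [fockInner_const_mul_left, map_mul, Complex.conj_conj, fockInner_conj_symm, mul_comm]

theorem polyKernel_eq_sum (hm : 0 < m) (n q : ℕ) (z w : ℂ) : polyKernel m n q z w
    = ∑ i ∈ Finset.range n ×ˢ Finset.range q,
      starRingEnd ℂ (fockBasis m i w) * fockBasis m i z := by
  have h : ∃ K, IsReproducingKernel m (polyanalyticPol n q) K := ⟨_, isReproducingKernel_sum hm n q⟩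
  rw [polyKernel, dif_pos h, h.choose_spec.unique (isReproducingKernel_sum hm n q)]

theorem polyKernel_self (hm : 0 < m) (n q : ℕ) (z : ℂ) : polyKernel m n q z z
    = (∑ i ∈ Finset.range n ×ˢ Finset.range q, ‖fockBasis m i z‖ ^ 2 : ℝ) := by
  rw [polyKernel_eq_sum hm]
  push_cast
  exact Finset.sum_congr rfl fun i _ => Complex.conj_mul' _

theorem polyKernel_self_re_pos (hm : 0 < m) {n q : ℕ} (hn : 1 ≤ n) (hq : 1 ≤ q) (z : ℂ) :
    0 < (polyKernel m n q z z).re := by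
  rw [polyKernel_self hm, Complex.ofReal_re]
  refine Finset.sum_pos' (fun _ _ => by positivity) ⟨(0, 0), by simp; omega, ?_⟩
  have : fockBasis m (0, 0) z ≠ 0 := by
    have : 0 < √m := Real.sqrt_pos.2 hm
    simp [fockBasis, itoHermite_zero, this.ne']
  positivity

/-- The unit vector `K(·, z) / √K(z, z)` of `Pol_{m,n,q}`, whose squared modulus is the Berezin
density at `z`. -/
noncomputable def berezinState (m : ℝ) (n q : ℕ) (z : ℂ) : ℂ → ℂ :=
  fun w => (((√(polyKernel m n q z z).re)⁻¹ : ℝ) : ℂ) * polyKernel m n q w z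

theorem berezinState_mem (hm : 0 < m) (n q : ℕ) (z : ℂ) :
    berezinState m n q z ∈ polyanalyticPol n q := by
  have : berezinState m n q z = (((√(polyKernel m n q z z).re)⁻¹ : ℝ) : ℂ) • fun w =>
      ∑ i ∈ Finset.range n ×ˢ Finset.range q,
        starRingEnd ℂ (fockBasis m i z) * fockBasis m i w := by
    ext w
    simp only [berezinState, polyKernel_eq_sum hm n q w z]
    rfl
  rw [this]
  exact Submodule.smul_mem _ _ (sum_fockBasis_mem _)

/-- Evaluation at `z` is a multiple of the pairing with the Berezin state. -/
theorem eval_eq_mul_fockInner_berezinState (hm : 0 < m) {n q : ℕ} (hn : 1 ≤ n) (hq : 1 ≤ q) (z : ℂ)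
    {f : ℂ → ℂ} (hf : f ∈ polyanalyticPol n q) :
    f z = (√(polyKernel m n q z z).re : ℂ) * fockInner m f (berezinState m n q z) := by
  have h := ((isReproducingKernel_sum hm n q) z).2 f hf
  simp only [← polyKernel_eq_sum hm] at h
  rw [← integral_fockMeasure] at h
  change f z = fockInner m f _ at h
  have h0 : (√(polyKernel m n q z z).re : ℂ) ≠ 0 := by
    exact_mod_cast (Real.sqrt_pos.2 (polyKernel_self_re_pos hm hn hq z)).ne'
  unfold berezinState
  rw [← fockInner_conj_symm, fockInner_const_mul_left, map_mul, Complex.conj_ofReal,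
    fockInner_conj_symm, ← mul_assoc, Complex.ofReal_inv, mul_inv_cancel₀ h0, one_mul, h]

theorem fockNorm_berezinState (hm : 0 < m) {n q : ℕ} (hn : 1 ≤ n) (hq : 1 ≤ q) (z : ℂ) :
    fockNorm m (berezinState m n q z) = 1 := by
  have hpos := polyKernel_self_re_pos hm hn hq z
  have h := eval_eq_mul_fockInner_berezinState hm hn hq z (berezinState_mem hm n q z)
  rw [fockInner_self, berezinState] at h
  have h1 : polyKernel m n q z z = ((polyKernel m n q z z).re : ℂ) := by
    rw [polyKernel_self hm, Complex.ofReal_re]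
  rw [h1] at h
  simp only [Complex.ofReal_re] at h
  have h2 : (√(polyKernel m n q z z).re)⁻¹ * (polyKernel m n q z z).re
      = √(polyKernel m n q z z).re * fockNorm m (berezinState m n q z) ^ 2 := by
    exact_mod_cast h
  have h3 : 0 < √(polyKernel m n q z z).re := Real.sqrt_pos.2 hpos
  have h4 : (√(polyKernel m n q z z).re)⁻¹ * (polyKernel m n q z z).re
      = √(polyKernel m n q z z).re := by
    nth_rewrite 2 [← Real.mul_self_sqrt hpos.le]
    rw [← mul_assoc, inv_mul_cancel₀ h3.ne', one_mul]
  rw [h4] at h2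
  have h5 : fockNorm m (berezinState m n q z) ^ 2 = 1 := by
    have := mul_left_cancel₀ h3.ne' ((mul_one _).trans h2)
    exact this.symm
  exact (pow_eq_one_iff_of_nonneg (fockNorm_nonneg _ _) two_ne_zero).1 h5

theorem berezinDensity_eq (hm : 0 < m) {n q : ℕ} (hn : 1 ≤ n) (hq : 1 ≤ q) (z w : ℂ) :
    berezinDensity m n q z w
      = ‖berezinState m n q z w‖ ^ 2 * Real.exp (-(m * ‖w‖ ^ 2)) := by
  have hpos := polyKernel_self_re_pos hm hn hq z
  have hsymm : ‖polyKernel m n q z w‖ = ‖polyKernel m n q w z‖ := by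
    rw [polyKernel_eq_sum hm, polyKernel_eq_sum hm, ← Complex.norm_conj, map_sum]
    congr 1
    exact Finset.sum_congr rfl fun i _ => by rw [map_mul, Complex.conj_conj, mul_comm]
  rw [berezinDensity, berezinState, norm_mul, mul_pow, Complex.norm_real, hsymm, norm_inv, inv_pow,
    Real.norm_of_nonneg (Real.sqrt_nonneg _), Real.sq_sqrt hpos.le]
  ring

theorem integral_mul_berezinDensity (hm : 0 < m) {n q : ℕ} (hn : 1 ≤ n) (hq : 1 ≤ q) (z : ℂ)
    (g : ℂ → ℂ) :
    ∫ w, g w * (berezinDensity m n q z w : ℂ) ∂normalizedArea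
      = ∫ w, g w * (‖berezinState m n q z w‖ ^ 2 : ℝ) ∂fockMeasure m := by
  rw [integral_fockMeasure]
  congr 1; ext w
  rw [berezinDensity_eq hm hn hq]
  push_cast
  ring

end Kernel

/-! ### Concentration of the Berezin state -/

section Concentration
variable {m : ℝ}

/-- The orthogonal projection of `f` to `Pol_{J,q}`. -/
noncomputable def fockProj (m : ℝ) (J q : ℕ) (f : ℂ → ℂ) : ℂ → ℂ :=
  fun w => ∑ i ∈ Finset.range J ×ˢ Finset.range q, fockInner m f (fockBasis m i) * fockBasis m i w

theorem fockProj_mem (J q : ℕ) (f : ℂ → ℂ) : fockProj m J q f ∈ polyanalyticPol J q :=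
  sum_fockBasis_mem _

theorem fockInner_fockProj_self (hm : 0 < m) (J q : ℕ) {f : ℂ → ℂ} (hf : PolyGrowth f) :
    fockInner m (fockProj m J q f) f = (fockNorm m (fockProj m J q f) ^ 2 : ℝ) := by
  have hG := polyGrowth_fockBasis (m := m)
  unfold fockProj
  rw [fockNorm_sum_sq hm _ (fun i => i) (fun _ _ _ _ h => h),
    fockInner_sum_left hm _ (fun i _ => (hG i).const_mul _) hf]
  push_cast
  refine Finset.sum_congr rfl fun i _ => ?_
  rw [fockInner_const_mul_left, ← Complex.mul_conj', fockInner_conj_symm]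

/-- The part of the Berezin state at `z` of degree less than `n - s` in `w` has norm about
`|z|^{-s}`: the Berezin state maximizes `|f(z)|` among the unit vectors of `Pol_{n,q}`, and
multiplication by `w ^ s` multiplies the value at `z` of such a part by `z ^ s`, without changing
its norm by much. -/
theorem norm_pow_mul_fockNorm_fockProj_le (hm : 0 < m) {J s q : ℕ} (hn : 1 ≤ J + s) (hq : 1 ≤ q)
    (z : ℂ) {B : ℝ} (hB : √((J + s : ℕ) / m) + √(q / m) ≤ B) :
    ‖z‖ ^ s * fockNorm m (fockProj m J q (berezinState m (J + s) q z)) ≤ B ^ s := by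
  have hB0 : 0 ≤ B := le_trans (by positivity) hB
  set ψ := berezinState m (J + s) q z with hψ
  set f := fockProj m J q ψ with hf
  have hfm : f ∈ polyanalyticPol J q := fockProj_mem J q ψ
  have hψm : ψ ∈ polyanalyticPol (J + s) q := berezinState_mem hm (J + s) q z
  have hψ1 : fockNorm m ψ = 1 := fockNorm_berezinState hm hn hq z
  have hκ := Real.sqrt_pos.2 (polyKernel_self_re_pos hm hn hq z)
  have h1 := eval_eq_mul_fockInner_berezinState hm hn hq z
    (polyanalyticPol_mono (Nat.le_add_right J s) le_rfl hfm)
  have h2 := eval_eq_mul_fockInner_berezinState hm hn hq z (pow_mul_mem_polyanalyticPol hfm s)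
  rw [← hψ, fockInner_fockProj_self hm J q (polyGrowth_of_mem hψm)] at h1
  rw [← hψ, h1] at h2
  generalize √(polyKernel m (J + s) q z z).re = κ at h1 h2 hκ
  have h3 := congr_arg norm h2
  simp only [norm_mul, norm_pow, Complex.norm_real, abs_of_pos hκ, Real.norm_eq_abs,
    abs_of_nonneg (fockNorm_nonneg _ _)] at h3
  have h4 := norm_fockInner_le hm (polyGrowth_of_mem (pow_mul_mem_polyanalyticPol hfm s))
    (polyGrowth_of_mem hψm)
  rw [hψ1, mul_one] at h4
  have h5 := h4.trans (fockNorm_pow_mul_le hm hfm s hB)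
  rcases (fockNorm_nonneg m f).eq_or_lt with h0 | h0
  · rw [← h0, mul_zero]; positivity
  · have h6 : κ * (‖z‖ ^ s * fockNorm m f ^ 2) ≤ κ * (B ^ s * fockNorm m f) := by
      calc _ = ‖z‖ ^ s * (κ * fockNorm m f ^ 2) := by ring
        _ = _ := h3
        _ ≤ _ := by gcongr
    have h7 := le_of_mul_le_mul_left h6 hκ
    refine le_of_mul_le_mul_right ?_ h0
    calc _ = ‖z‖ ^ s * fockNorm m f ^ 2 := by ring
      _ ≤ _ := h7

theorem polyGrowth_norm_sq_sub_one : PolyGrowth fun w => ((‖w‖ ^ 2 - 1 : ℝ) : ℂ) := by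
  have h : (fun w : ℂ => ((‖w‖ ^ 2 - 1 : ℝ) : ℂ)) = fun w => w * starRingEnd ℂ w - 1 := by
    ext w
    rw [Complex.mul_conj']; push_cast; ring
  rw [h]
  exact (PolyGrowth.id.mul PolyGrowth.id.conj).sub (PolyGrowth.const 1)

/-- The Berezin state at `z` is concentrated near the unit circle, quantitatively. -/
theorem fockNorm_sq_sub_one_mul_berezinState_le (hm : 0 < m) {J s q : ℕ} (hn : 1 ≤ J + s)
    (hq : 1 ≤ q) {z : ℂ} (hz : z ≠ 0) {B η : ℝ} (hB : √((J + s + 2 : ℕ) / m) + √(q / m) ≤ B)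
    (hη : 0 ≤ η)
    (h1 : ∀ i ∈ Finset.Ico J (J + s) ×ˢ Finset.range q, |((i.1 + i.2 + 1 : ℝ) / m) - 1| ≤ η)
    (h2 : ∀ i ∈ Finset.Ico J (J + s) ×ˢ Finset.range q,
      √((i.2 + 1) / m) * √((i.1 + 1) / m) ≤ η) :
    fockNorm m (fun w => ((‖w‖ ^ 2 - 1 : ℝ) : ℂ) * berezinState m (J + s) q z w)
      ≤ (B ^ 2 + 1) * (B / ‖z‖) ^ s + 3 * η := by
  have hz0 : 0 < ‖z‖ := norm_pos_iff.2 hz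
  set ψ := berezinState m (J + s) q z with hψ
  have hψm : ψ ∈ polyanalyticPol (J + s) q := berezinState_mem hm (J + s) q z
  have hψ1 : fockNorm m ψ = 1 := fockNorm_berezinState hm hn hq z
  set f := fockProj m J q ψ with hf
  have hfm : f ∈ polyanalyticPol J q := fockProj_mem J q ψ
  set S := Finset.range (J + s) ×ˢ Finset.range q with hS
  set S' := Finset.Ico J (J + s) ×ˢ Finset.range q with hS'
  set h : ℂ → ℂ := fun w => ∑ i ∈ S', fockInner m ψ (fockBasis m i) * fockBasis m i w with hh
  have hG := polyGrowth_fockBasis (m := m)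
  have hfG := polyGrowth_of_mem hfm
  have hhG : PolyGrowth h := PolyGrowth.sum _ fun i _ => (hG i).const_mul _
  have hsplit : ∀ w, ψ w = f w + h w := by
    intro w
    have : S = (Finset.range J ×ˢ Finset.range q) ∪ S' := by
      ext i
      simp only [hS, hS', Finset.mem_union, Finset.mem_product, Finset.mem_range, Finset.mem_Ico]
      omega
    have hd : Disjoint (Finset.range J ×ˢ Finset.range q) S' := by
      rw [Finset.disjoint_left]
      intro i
      simp only [hS', Finset.mem_product, Finset.mem_range, Finset.mem_Ico]
      omega
    refine (congr_fun (eq_sum_of_mem hm hψm) w).trans ?_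
    simp only [← hS, this]
    exact Finset.sum_union hd
  have hh1 : fockNorm m h ≤ 1 := by
    refine le_of_sq_le_sq ?_ zero_le_one
    rw [← hψ1, eq_sum_of_mem hm hψm, hh, fockNorm_sum_sq hm S' (fun i => i) (fun _ _ _ _ h => h),
      fockNorm_sum_sq hm _ (fun i => i) (fun _ _ _ _ h => h)]
    refine Finset.sum_le_sum_of_subset_of_nonneg ?_ fun _ _ _ => by positivity
    intro i
    simp only [hS', Finset.mem_product, Finset.mem_range, Finset.mem_Ico]
    omega
  have hB' : √((J + s : ℕ) / m) + √(q / m) ≤ B := by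
    refine le_trans ?_ hB
    have : ((J + s : ℕ) : ℝ) ≤ (J + s + 2 : ℕ) := by exact_mod_cast Nat.le_add_right _ _
    gcongr √(?_ / m) + _
  have hB'' : √((J + 2 : ℕ) / m) + √(q / m) ≤ B := by
    refine le_trans ?_ hB
    have : ((J + 2 : ℕ) : ℝ) ≤ (J + s + 2 : ℕ) := by exact_mod_cast (by omega)
    gcongr √(?_ / m) + _
  have hf1 : fockNorm m f ≤ (B / ‖z‖) ^ s := by
    rw [div_pow, le_div_iff₀ (by positivity), mul_comm]
    exact norm_pow_mul_fockNorm_fockProj_le hm hn hq z hB'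
  have hf2 : fockNorm m (fun w => ((‖w‖ ^ 2 - 1 : ℝ) : ℂ) * f w) ≤ (B ^ 2 + 1) * fockNorm m f := by
    have e1 := fockNorm_pow_mul_le hm hfm 2 hB''
    have e2 : fockNorm m (fun w => ((‖w‖ ^ 2 : ℝ) : ℂ) * f w) = fockNorm m (fun w => w ^ 2 * f w) :=
      fockNorm_congr m fun w => by simp
    have hG2 : PolyGrowth fun w => ((‖w‖ ^ 2 : ℝ) : ℂ) * f w :=
      ((PolyGrowth.id.pow 2).mul hfG).congr_norm
        ((by fun_prop : Continuous fun w : ℂ => ((‖w‖ ^ 2 : ℝ) : ℂ)).mul hfG.1)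
        fun w => by simp
    have e3 := fockNorm_sub_le hm hG2 hfG
    have e4 : (fun w => ((‖w‖ ^ 2 - 1 : ℝ) : ℂ) * f w)
        = fun w => ((‖w‖ ^ 2 : ℝ) : ℂ) * f w - f w := by
      ext w; push_cast; ring
    rw [e4]
    linarith
  have hh2 : fockNorm m (fun w => ((‖w‖ ^ 2 - 1 : ℝ) : ℂ) * h w) ≤ 3 * η * fockNorm m h :=
    fockNorm_sq_sub_one_mul_le hm S' _ h1 h2 hη
  have e5 : (fun w => ((‖w‖ ^ 2 - 1 : ℝ) : ℂ) * ψ w) = fun w =>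
      ((‖w‖ ^ 2 - 1 : ℝ) : ℂ) * f w + ((‖w‖ ^ 2 - 1 : ℝ) : ℂ) * h w := by
    ext w; rw [hsplit w]; ring
  rw [e5]
  calc _ ≤ _ := fockNorm_add_le hm (polyGrowth_norm_sq_sub_one.mul hfG)
          (polyGrowth_norm_sq_sub_one.mul hhG)
    _ ≤ (B ^ 2 + 1) * fockNorm m f + 3 * η * fockNorm m h := add_le_add hf2 hh2
    _ ≤ (B ^ 2 + 1) * (B / ‖z‖) ^ s + 3 * η * 1 := by gcongr
    _ = _ := by ring

end Concentration

/-! ### Powers of the multiplication operators -/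

section Approximation
variable {m : ℝ}

/-- Up to an error of order `m^{-1/2}`, multiplication by `conj w ^ s` maps `Pol_{n+s,q}` to
`Pol_{n,q}`. -/
theorem exists_fockNorm_conj_pow_mul_sub_le (hm : 0 < m) {n q s N : ℕ} (hN : n + 2 * s ≤ N)
    {B : ℝ} (hB1 : 1 ≤ B) (hB : √(N / m) + √((q + 1 : ℕ) / m) ≤ B) {f : ℂ → ℂ}
    (hf : f ∈ polyanalyticPol (n + s) q) :
    ∃ φ ∈ polyanalyticPol n q,
      fockNorm m (fun w => starRingEnd ℂ w ^ s * f w - φ w)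
        ≤ s * B ^ s * √(q / m) * fockNorm m f := by
  induction s generalizing f with
  | zero =>
    refine ⟨f, hf, ?_⟩
    simp [fockNorm]
  | succ s ih =>
    obtain ⟨φ₁, hφ₁, h1, h2⟩ := exists_fockNorm_conj_mul_sub_le hm (n := n + s) hf
    obtain ⟨φ, hφ, h3⟩ := ih (by omega) hφ₁
    refine ⟨φ, hφ, ?_⟩
    have hr : (fun w => starRingEnd ℂ w * f w - φ₁ w) ∈ polyanalyticPol (n + s + 1) (q + 1) :=
      Submodule.sub_mem _ (conj_mul_mem_polyanalyticPol hf)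
        (polyanalyticPol_mono (by omega) (by omega) hφ₁)
    have hNs : ((n + s + 1 + s : ℕ) : ℝ) ≤ N := by exact_mod_cast (by omega)
    have hNs' : ((n + s + 1 : ℕ) : ℝ) ≤ N := by exact_mod_cast (by omega)
    have h4 := fockNorm_pow_mul_le hm hr (B := B) s (le_trans (by gcongr √(?_ / m) + _) hB)
    have h5 : fockNorm m φ₁ ≤ B * fockNorm m f := by
      refine h2.trans (mul_le_mul_of_nonneg_right ?_ (fockNorm_nonneg _ _))
      calc √((n + s + 1 : ℕ) / m) ≤ √(N / m) := by gcongr √(?_ / m)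
        _ ≤ √(N / m) + √((q + 1 : ℕ) / m) := le_add_of_nonneg_right (Real.sqrt_nonneg _)
        _ ≤ B := hB
    have hrG := polyGrowth_of_mem hr
    have h6 : fockNorm m (fun w => starRingEnd ℂ w ^ s * (starRingEnd ℂ w * f w - φ₁ w))
        = fockNorm m (fun w => w ^ s * (starRingEnd ℂ w * f w - φ₁ w)) :=
      fockNorm_congr m fun w => by simp
    have h7 : (fun w => starRingEnd ℂ w ^ (s + 1) * f w - φ w)
        = fun w => starRingEnd ℂ w ^ s * (starRingEnd ℂ w * f w - φ₁ w)
          + (starRingEnd ℂ w ^ s * φ₁ w - φ w) := by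
      ext w; ring
    rw [h7]
    have hB0 : 0 ≤ B := zero_le_one.trans hB1
    have hf0 := fockNorm_nonneg m f
    calc _ ≤ _ := fockNorm_add_le hm ((PolyGrowth.id.conj.pow s).mul hrG)
          (((PolyGrowth.id.conj.pow s).mul (polyGrowth_of_mem hφ₁)).sub (polyGrowth_of_mem hφ))
      _ ≤ B ^ s * (√(q / m) * fockNorm m f) + s * B ^ s * √(q / m) * (B * fockNorm m f) := by
        rw [h6]
        refine add_le_add (h4.trans ?_) (h3.trans ?_)
        · gcongr
        · gcongr
      _ ≤ B ^ (s + 1) * (√(q / m) * fockNorm m f)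
          + s * B ^ s * √(q / m) * (B * fockNorm m f) := by
        gcongr
        exact Nat.le_succ s
      _ = _ := by push_cast; ring

theorem sq_sub_one_mul_mem {n q : ℕ} {f : ℂ → ℂ} (hf : f ∈ polyanalyticPol n q) :
    (fun w => ((‖w‖ ^ 2 - 1 : ℝ) : ℂ) * f w) ∈ polyanalyticPol (n + 1) (q + 1) := by
  have h : (fun w => ((‖w‖ ^ 2 - 1 : ℝ) : ℂ) * f w)
      = (fun w => w * (starRingEnd ℂ w * f w)) - f := by
    ext w
    rw [Pi.sub_apply, ← mul_assoc, Complex.mul_conj']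
    push_cast
    ring
  rw [h]
  exact Submodule.sub_mem _ (mul_mem_polyanalyticPol (conj_mul_mem_polyanalyticPol hf))
    (polyanalyticPol_mono (by omega) (by omega) hf)

theorem PolyGrowth.integrable_norm_sq (hm : 0 < m) {f : ℂ → ℂ} (hf : PolyGrowth f) :
    Integrable (fun w => ‖f w‖ ^ 2) (fockMeasure m) :=
  (memLp_two_iff_integrable_sq_norm hf.1.aestronglyMeasurable).1 (hf.memLp hm)

theorem integral_sq_sub_one_mul_le (hm : 0 < m) {n q : ℕ} {f : ℂ → ℂ}
    (hf : f ∈ polyanalyticPol n q) (d : ℕ) {B : ℝ}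
    (hB : √((n + 1 + d : ℕ) / m) + √((q + 1 : ℕ) / m) ≤ B) :
    ∫ w, (‖w‖ ^ 2 - 1) ^ 2 * (1 + ‖w‖ ^ 2) ^ d * ‖f w‖ ^ 2 ∂fockMeasure m
      ≤ 2 ^ (d - 1) * (1 + (B ^ d) ^ 2)
        * fockNorm m (fun w => ((‖w‖ ^ 2 - 1 : ℝ) : ℂ) * f w) ^ 2 := by
  have hu := sq_sub_one_mul_mem hf
  set u : ℂ → ℂ := fun w => ((‖w‖ ^ 2 - 1 : ℝ) : ℂ) * f w with hu'
  have huG := polyGrowth_of_mem hu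
  have hvG := (PolyGrowth.id.pow d).mul huG
  have h1 := fockNorm_pow_mul_le hm hu d hB
  have h2 : ∀ w, (‖w‖ ^ 2 - 1) ^ 2 * (1 + ‖w‖ ^ 2) ^ d * ‖f w‖ ^ 2
      ≤ 2 ^ (d - 1) * (‖u w‖ ^ 2 + ‖w ^ d * u w‖ ^ 2) := by
    intro w
    have h3 := add_pow_le (zero_le_one (α := ℝ)) (sq_nonneg ‖w‖) d
    rw [one_pow] at h3
    have h4 : ‖u w‖ ^ 2 = (‖w‖ ^ 2 - 1) ^ 2 * ‖f w‖ ^ 2 := by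
      rw [hu', norm_mul, mul_pow, Complex.norm_real, Real.norm_eq_abs, sq_abs]
    have h5 : ‖w ^ d * u w‖ ^ 2 = (‖w‖ ^ 2) ^ d * ‖u w‖ ^ 2 := by
      rw [norm_mul, norm_pow]; ring
    rw [h5, h4]
    calc _ = (1 + ‖w‖ ^ 2) ^ d * ((‖w‖ ^ 2 - 1) ^ 2 * ‖f w‖ ^ 2) := by ring
      _ ≤ (2 ^ (d - 1) * (1 + (‖w‖ ^ 2) ^ d)) * ((‖w‖ ^ 2 - 1) ^ 2 * ‖f w‖ ^ 2) := by gcongr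
      _ = _ := by ring
  calc _ ≤ ∫ w, 2 ^ (d - 1) * (‖u w‖ ^ 2 + ‖w ^ d * u w‖ ^ 2) ∂fockMeasure m := by
        refine integral_mono_of_nonneg (Eventually.of_forall fun w => by positivity)
          (((huG.integrable_norm_sq hm).add (hvG.integrable_norm_sq hm)).const_mul _)
          (Eventually.of_forall h2)
    _ = 2 ^ (d - 1) * (fockNorm m u ^ 2 + fockNorm m (fun w => w ^ d * u w) ^ 2) := by
        rw [integral_const_mul, integral_add (huG.integrable_norm_sq hm)
          (hvG.integrable_norm_sq hm), fockNorm_sq, fockNorm_sq]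
    _ ≤ 2 ^ (d - 1) * (fockNorm m u ^ 2 + (B ^ d * fockNorm m u) ^ 2) := by
        have := fockNorm_nonneg m (fun w => w ^ d * u w)
        gcongr
    _ = _ := by ring

end Approximation

/-! ### Asymptotics along the near-diagonal pairs -/

section Asymptotics
variable {M : ℝ}

theorem tendsto_fst_nearDiagonal : Tendsto (fun p : ℝ × ℕ => p.1) (nearDiagonal M) atTop :=
  tendsto_fst.mono_left inf_le_left

theorem tendsto_snd_nearDiagonal : Tendsto (fun p : ℝ × ℕ => p.2) (nearDiagonal M) atTop :=
  tendsto_snd.mono_left inf_le_left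

theorem eventually_abs_sub_le_nearDiagonal :
    ∀ᶠ p : ℝ × ℕ in nearDiagonal M, |(p.2 : ℝ) - p.1| ≤ M :=
  mem_inf_of_right (mem_principal_self _)

theorem tendsto_const_div_nearDiagonal (C : ℝ) :
    Tendsto (fun p : ℝ × ℕ => C / p.1) (nearDiagonal M) (𝓝 0) :=
  tendsto_const_nhds.div_atTop tendsto_fst_nearDiagonal

theorem tendsto_sqrt_const_div_nearDiagonal (C : ℝ) :
    Tendsto (fun p : ℝ × ℕ => √(C / p.1)) (nearDiagonal M) (𝓝 0) := by
  simpa using (tendsto_const_div_nearDiagonal C).sqrt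

theorem tendsto_add_div_nearDiagonal (s : ℕ) :
    Tendsto (fun p : ℝ × ℕ => ((p.2 + s : ℕ) : ℝ) / p.1) (nearDiagonal M) (𝓝 1) := by
  rw [tendsto_iff_dist_tendsto_zero]
  refine squeeze_zero' (Eventually.of_forall fun _ => dist_nonneg) ?_
    (tendsto_const_div_nearDiagonal (M := M) (M + s))
  filter_upwards [eventually_abs_sub_le_nearDiagonal,
    tendsto_fst_nearDiagonal.eventually_gt_atTop 0] with p hp hp0
  have h : ((p.2 + s : ℕ) : ℝ) / p.1 - 1 = ((p.2 - p.1) + s) / p.1 := by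
    push_cast; field_simp; ring
  rw [Real.dist_eq, h, abs_div, abs_of_pos hp0]
  gcongr
  refine (abs_add_le _ _).trans ?_
  rw [Nat.abs_cast]
  linarith

theorem tendsto_sqrt_add_sqrt_nearDiagonal (s q : ℕ) :
    Tendsto (fun p : ℝ × ℕ => √((p.2 + s : ℕ) / p.1) + √(q / p.1)) (nearDiagonal M) (𝓝 1) := by
  simpa using (tendsto_add_div_nearDiagonal s).sqrt.add (tendsto_sqrt_const_div_nearDiagonal q)

/-- The Berezin state at an exterior point concentrates on the unit circle. -/
theorem tendsto_fockNorm_sq_sub_one_mul_berezinState {q : ℕ} (hq : 1 ≤ q) {z : ℂ} (hz : 1 < ‖z‖) :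
    Tendsto (fun p : ℝ × ℕ =>
      fockNorm p.1 fun w => ((‖w‖ ^ 2 - 1 : ℝ) : ℂ) * berezinState p.1 p.2 q z w)
      (nearDiagonal M) (𝓝 0) := by
  have hz0 : 0 < ‖z‖ := zero_lt_one.trans hz
  obtain ⟨ρ, hρ1, hρz⟩ := exists_between hz
  refine tendsto_order.2 ⟨fun a ha =>
    Eventually.of_forall fun p => ha.trans_le (fockNorm_nonneg _ _),
    fun ε hε => ?_⟩
  have hρ : Tendsto (fun s : ℕ => (ρ ^ 2 + 1) * (ρ / ‖z‖) ^ s) atTop (𝓝 0) := by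
    simpa using (tendsto_pow_atTop_nhds_zero_of_lt_one (by positivity)
      ((div_lt_one hz0).2 hρz)).const_mul (ρ ^ 2 + 1)
  obtain ⟨s, hs⟩ := (hρ.eventually_lt_const (half_pos hε)).exists
  have hη : Tendsto (fun p : ℝ × ℕ => 3 * ((|M| + s + q + 1) / p.1
      + √(q / p.1) * √((p.2 + 0 : ℕ) / p.1))) (nearDiagonal M) (𝓝 0) := by
    simpa using ((tendsto_const_div_nearDiagonal (|M| + s + q + 1)).add
      ((tendsto_sqrt_const_div_nearDiagonal q).mul
        (tendsto_add_div_nearDiagonal 0).sqrt)).const_mul 3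
  filter_upwards [tendsto_fst_nearDiagonal.eventually_gt_atTop 0,
    eventually_abs_sub_le_nearDiagonal, tendsto_snd_nearDiagonal.eventually_ge_atTop (s + 1),
    hη.eventually_lt_const (half_pos hε),
    (tendsto_sqrt_add_sqrt_nearDiagonal 2 q).eventually_lt_const hρ1] with p hp0 hpM hps hpη hpρ
  obtain ⟨m, n⟩ := p
  obtain ⟨J, rfl⟩ : ∃ J, n = J + s := ⟨n - s, by simp at hps; omega⟩
  simp only [add_zero] at *
  have hMM : M ≤ |M| := le_abs_self M
  refine (fockNorm_sq_sub_one_mul_berezinState_le hp0 (J := J) (s := s) (by omega) hq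
    (norm_pos_iff.1 hz0) hpρ.le (η := (|M| + s + q + 1) / m + √(q / m) * √((J + s : ℕ) / m))
    (by positivity) ?_ ?_).trans_lt (by linarith)
  · intro i hi
    simp only [Finset.mem_product, Finset.mem_Ico, Finset.mem_range] at hi
    have h1 : (i.1 + i.2 + 1 : ℝ) / m - 1 = (i.1 + i.2 + 1 - m) / m := by field_simp
    rw [h1, abs_div, abs_of_pos hp0]
    refine le_add_of_le_of_nonneg ?_ (by positivity)
    gcongr
    have h2 : (J : ℝ) ≤ i.1 := by exact_mod_cast hi.1.1
    have h3 : (i.1 : ℝ) ≤ J + s := by exact_mod_cast hi.1.2.le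
    have h4 : (i.2 : ℝ) ≤ q := by exact_mod_cast hi.2.le
    have h5 := i.2.cast_nonneg (α := ℝ)
    have h6 := s.cast_nonneg (α := ℝ)
    have h7 := q.cast_nonneg (α := ℝ)
    have h8 := abs_le.1 hpM
    push_cast at h8
    rw [abs_le]
    constructor <;> linarith
  · intro i hi
    simp only [Finset.mem_product, Finset.mem_Ico, Finset.mem_range] at hi
    refine le_add_of_nonneg_of_le (by positivity) ?_
    gcongr
    · exact_mod_cast hi.2
    · exact_mod_cast hi.1.2

theorem tendsto_integral_sq_sub_one_mul_berezinState {q : ℕ} (hq : 1 ≤ q) {z : ℂ} (hz : 1 < ‖z‖)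
    (d : ℕ) :
    Tendsto (fun p : ℝ × ℕ => ∫ w, (‖w‖ ^ 2 - 1) ^ 2 * (1 + ‖w‖ ^ 2) ^ d
      * ‖berezinState p.1 p.2 q z w‖ ^ 2 ∂fockMeasure p.1) (nearDiagonal M) (𝓝 0) := by
  have h1 := ((tendsto_fockNorm_sq_sub_one_mul_berezinState (M := M) hq hz).pow 2).const_mul
    (2 ^ (d - 1) * (1 + ((2 : ℝ) ^ d) ^ 2))
  simp only [ne_eq, OfNat.ofNat_ne_zero, not_false_eq_true, zero_pow, mul_zero] at h1
  refine squeeze_zero' (Eventually.of_forall fun p => integral_nonneg fun w => by positivity) ?_ h1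
  filter_upwards [tendsto_fst_nearDiagonal.eventually_gt_atTop 0,
    (tendsto_sqrt_add_sqrt_nearDiagonal (1 + d) (q + 1)).eventually_lt_const one_lt_two]
    with p hp0 hpB
  rw [← add_assoc] at hpB
  exact integral_sq_sub_one_mul_le hp0 (berezinState_mem hp0 _ _ _) d hpB.le

theorem abs_pow_sub_one_le {x : ℝ} (hx : 0 ≤ x) (s : ℕ) :
    |x ^ s - 1| ≤ s * |x - 1| * (1 + x) ^ s := by
  rw [← mul_geom_sum, abs_mul, mul_comm (s : ℝ), mul_assoc]
  refine mul_le_mul_of_nonneg_left ?_ (abs_nonneg _)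
  rw [abs_of_nonneg (Finset.sum_nonneg fun _ _ => by positivity)]
  calc ∑ i ∈ Finset.range s, x ^ i ≤ ∑ _i ∈ Finset.range s, (1 + x) ^ s := by
        refine Finset.sum_le_sum fun i hi => ?_
        calc x ^ i ≤ (1 + x) ^ i := by gcongr; linarith
          _ ≤ (1 + x) ^ s := by
            gcongr
            · linarith
            · exact (Finset.mem_range.1 hi).le
    _ = _ := by simp

/-- The moments of the Berezin measure at `z` converge to those of the harmonic measure at `z`.
With `φ` the approximation of `conj w ^ s * ψ` in `Pol_{n-s,q}`, for the Berezin state `ψ`, the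
reproducing property gives `z ^ s ⟨φ, ψ⟩ = ⟨w ^ s φ, ψ⟩`, which is close to `⟨ψ, ψ⟩ = 1` because
`w ^ s conj w ^ s ψ` is close to `ψ`. -/
theorem tendsto_fockInner_conj_pow_mul_berezinState {q : ℕ} (hq : 1 ≤ q) {z : ℂ} (hz : 1 < ‖z‖)
    (s : ℕ) :
    Tendsto (fun p : ℝ × ℕ => fockInner p.1
      (fun w => starRingEnd ℂ w ^ s * berezinState p.1 p.2 q z w) (berezinState p.1 p.2 q z))
      (nearDiagonal M) (𝓝 ((z ^ s)⁻¹)) := by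
  have hz0 : z ≠ 0 := norm_pos_iff.1 (zero_lt_one.trans hz)
  have hlim : Tendsto (fun p : ℝ × ℕ => (1 + 2 ^ s) * (s * 2 ^ s * √(q / p.1))
      + √((s : ℝ) ^ 2 * ∫ w, (‖w‖ ^ 2 - 1) ^ 2 * (1 + ‖w‖ ^ 2) ^ (2 * s)
        * ‖berezinState p.1 p.2 q z w‖ ^ 2 ∂fockMeasure p.1)) (nearDiagonal M) (𝓝 0) := by
    have h1 := ((tendsto_sqrt_const_div_nearDiagonal (M := M) q).const_mul
      ((s : ℝ) * 2 ^ s)).const_mul (1 + 2 ^ s)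
    have h2 := ((tendsto_integral_sq_sub_one_mul_berezinState (M := M) hq hz (2 * s)).const_mul
      ((s : ℝ) ^ 2)).sqrt
    simpa using h1.add h2
  rw [tendsto_iff_norm_sub_tendsto_zero]
  refine squeeze_zero' (Eventually.of_forall fun _ => norm_nonneg _) ?_ hlim
  filter_upwards [tendsto_fst_nearDiagonal.eventually_gt_atTop 0,
    tendsto_snd_nearDiagonal.eventually_ge_atTop (s + 1),
    (tendsto_sqrt_add_sqrt_nearDiagonal s (q + s)).eventually_lt_const one_lt_two,
    (tendsto_sqrt_add_sqrt_nearDiagonal s (q + 1)).eventually_lt_const one_lt_two]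
    with p hm hps hpB hpB'
  obtain ⟨m, n⟩ := p
  obtain ⟨J, rfl⟩ : ∃ J, n = J + s := ⟨n - s, by simp at hps; omega⟩
  simp only at *
  have hn : 1 ≤ J + s := by omega
  set ψ := berezinState m (J + s) q z with hψ
  have hψm : ψ ∈ polyanalyticPol (J + s) q := berezinState_mem hm (J + s) q z
  have hψ1 : fockNorm m ψ = 1 := fockNorm_berezinState hm hn hq z
  have hψG := polyGrowth_of_mem hψm
  obtain ⟨φ, hφ, h1⟩ := exists_fockNorm_conj_pow_mul_sub_le hm (n := J) (s := s) (N := J + s + s)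
    (by omega) one_le_two hpB'.le hψm
  rw [hψ1, mul_one] at h1
  have hφG := polyGrowth_of_mem hφ
  set ε := s * 2 ^ s * √(q / m) with hε
  have hcG : PolyGrowth fun w => starRingEnd ℂ w ^ s * ψ w := (PolyGrowth.id.conj.pow s).mul hψG
  have hrG : PolyGrowth fun w => starRingEnd ℂ w ^ s * ψ w - φ w := hcG.sub hφG
  have hconj : ∀ t, (fun w => starRingEnd ℂ w ^ t * ψ w) ∈ polyanalyticPol (J + s) (q + t) := by
    intro t
    induction t with
    | zero => simpa using hψm
    | succ t ih =>
      simp only [pow_succ', mul_assoc]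
      exact conj_mul_mem_polyanalyticPol ih
  have hrm : (fun w => starRingEnd ℂ w ^ s * ψ w - φ w) ∈ polyanalyticPol (J + s) (q + s) :=
    Submodule.sub_mem _ (hconj s) (polyanalyticPol_mono (by omega) (by omega) hφ)
  -- evaluation at `z`
  have h2 : z ^ s * fockInner m φ ψ = fockInner m (fun w => w ^ s * φ w) ψ := by
    have e1 := eval_eq_mul_fockInner_berezinState hm hn hq z
      (polyanalyticPol_mono (Nat.le_add_right J s) le_rfl hφ)
    have e2 := eval_eq_mul_fockInner_berezinState hm hn hq z (pow_mul_mem_polyanalyticPol hφ s)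
    have hκ : (√(polyKernel m (J + s) q z z).re : ℂ) ≠ 0 := by
      exact_mod_cast (Real.sqrt_pos.2 (polyKernel_self_re_pos hm hn hq z)).ne'
    rw [← hψ] at e1 e2
    rw [e1] at e2
    refine mul_left_cancel₀ hκ ?_
    linear_combination e2
  have h3 : fockNorm m (fun w => w ^ s * (starRingEnd ℂ w ^ s * ψ w - φ w)) ≤ 2 ^ s * ε :=
    (fockNorm_pow_mul_le hm hrm s hpB.le).trans (by gcongr)
  set R : ℝ := ∫ w, (‖w‖ ^ 2 - 1) ^ 2 * (1 + ‖w‖ ^ 2) ^ (2 * s) * ‖ψ w‖ ^ 2 ∂fockMeasure m with hR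
  have hsG : PolyGrowth fun w => ((‖w‖ ^ 2) ^ s - 1 : ℝ) * ψ w := by
    have e : (fun w => (((‖w‖ ^ 2) ^ s - 1 : ℝ) : ℂ) * ψ w)
        = fun w => w ^ s * (starRingEnd ℂ w ^ s * ψ w) - ψ w := by
      ext w
      rw [← mul_assoc, ← mul_pow, Complex.mul_conj']
      push_cast
      ring
    rw [e]
    exact ((PolyGrowth.id.pow s).mul hcG).sub hψG
  have hwG : PolyGrowth fun w =>
      (((‖w‖ ^ 2 - 1 : ℝ) : ℂ) * (1 + w * starRingEnd ℂ w) ^ s) * ψ w :=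
    (polyGrowth_norm_sq_sub_one.mul
      (((PolyGrowth.const 1).add (PolyGrowth.id.mul PolyGrowth.id.conj)).pow s)).mul hψG
  have h4 : fockNorm m (fun w => ((‖w‖ ^ 2) ^ s - 1 : ℝ) * ψ w) ≤ √(s ^ 2 * R) := by
    refine Real.sqrt_le_sqrt ?_
    rw [hR, ← integral_const_mul]
    have hint := (hwG.integrable_norm_sq hm).const_mul ((s : ℝ) ^ 2)
    have e : ∀ w : ℂ, ‖(((‖w‖ ^ 2 - 1 : ℝ) : ℂ) * (1 + w * starRingEnd ℂ w) ^ s) * ψ w‖ ^ 2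
        = (‖w‖ ^ 2 - 1) ^ 2 * (1 + ‖w‖ ^ 2) ^ (2 * s) * ‖ψ w‖ ^ 2 := by
      intro w
      have e1 : (1 + w * starRingEnd ℂ w : ℂ) = ((1 + ‖w‖ ^ 2 : ℝ) : ℂ) := by
        rw [Complex.mul_conj']; push_cast; ring
      rw [e1, norm_mul, norm_mul, norm_pow, Complex.norm_real, Complex.norm_real,
        Real.norm_of_nonneg (show (0 : ℝ) ≤ 1 + ‖w‖ ^ 2 by positivity), mul_pow, mul_pow,
        Real.norm_eq_abs, sq_abs, ← pow_mul, mul_comm s]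
    simp only [e] at hint
    refine integral_mono (hsG.integrable_norm_sq hm) hint fun w => ?_
    have e2 := abs_pow_sub_one_le (sq_nonneg ‖w‖) s
    change ‖(((‖w‖ ^ 2) ^ s - 1 : ℝ) : ℂ) * ψ w‖ ^ 2 ≤ _
    rw [norm_mul, Complex.norm_real, Real.norm_eq_abs, mul_pow]
    calc _ ≤ (s * |‖w‖ ^ 2 - 1| * (1 + ‖w‖ ^ 2) ^ s) ^ 2 * ‖ψ w‖ ^ 2 := by gcongr
      _ = _ := by
        rw [mul_pow, mul_pow, sq_abs]; ring
  -- `w ^ s φ` is close to `ψ`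
  have h5 : ‖fockInner m (fun w => w ^ s * φ w) ψ - 1‖ ≤ 2 ^ s * ε + √(s ^ 2 * R) := by
    have e1 : (1 : ℂ) = fockInner m ψ ψ := by rw [fockInner_self, hψ1]; simp
    have hwφ : PolyGrowth fun w => w ^ s * φ w := (PolyGrowth.id.pow s).mul hφG
    rw [e1, ← fockInner_sub_left hm hwφ hψG hψG]
    refine (norm_fockInner_le hm (hwφ.sub hψG) hψG).trans ?_
    rw [hψ1, mul_one]
    have e2 : (fun w => w ^ s * φ w - ψ w) = fun w => ((((‖w‖ ^ 2) ^ s - 1 : ℝ) : ℂ) * ψ w)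
        - w ^ s * (starRingEnd ℂ w ^ s * ψ w - φ w) := by
      ext w
      have : (((‖w‖ ^ 2) ^ s - 1 : ℝ) : ℂ) = w ^ s * starRingEnd ℂ w ^ s - 1 := by
        rw [← mul_pow, Complex.mul_conj']; push_cast; ring
      rw [this]; ring
    rw [e2, add_comm]
    exact (fockNorm_sub_le hm hsG ((PolyGrowth.id.pow s).mul hrG)).trans (add_le_add h4 h3)
  have h6 : ‖fockInner m (fun w => starRingEnd ℂ w ^ s * ψ w) ψ - fockInner m φ ψ‖ ≤ ε := by
    rw [← fockInner_sub_left hm hcG hφG hψG]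
    refine (norm_fockInner_le hm hrG hψG).trans ?_
    rwa [hψ1, mul_one]
  have h7 : ‖fockInner m φ ψ - (z ^ s)⁻¹‖ ≤ 2 ^ s * ε + √(s ^ 2 * R) := by
    refine le_trans ?_ h5
    have hzs : z ^ s ≠ 0 := pow_ne_zero _ hz0
    rw [← h2, ← mul_inv_cancel₀ hzs, ← mul_sub, norm_mul, norm_pow]
    exact le_mul_of_one_le_left (norm_nonneg _) (one_le_pow₀ hz.le)
  calc _ = ‖(fockInner m (fun w => starRingEnd ℂ w ^ s * ψ w) ψ - fockInner m φ ψ)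
        + (fockInner m φ ψ - (z ^ s)⁻¹)‖ := by congr 1; ring
    _ ≤ ε + (2 ^ s * ε + √(s ^ 2 * R)) := (norm_add_le _ _).trans (add_le_add h6 h7)
    _ = _ := by ring

end Asymptotics

/-! ### Trigonometric polynomials and the method of moments -/

/-- Trigonometric polynomials, extended from the unit circle to the plane: the span of the functions
`w ^ s` and `conj w ^ s`. -/
def trigPol : Submodule ℂ (ℂ → ℂ) :=
  Submodule.span ℂ {f | ∃ s : ℕ, f = (fun w => w ^ s) ∨ f = fun w => starRingEnd ℂ w ^ s}

theorem polyGrowth_of_mem_trigPol {p : ℂ → ℂ} (hp : p ∈ trigPol) : PolyGrowth p := by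
  induction hp using Submodule.span_induction with
  | mem g hg =>
    obtain ⟨s, rfl | rfl⟩ := hg
    exacts [PolyGrowth.id.pow s, PolyGrowth.id.conj.pow s]
  | zero => exact PolyGrowth.const 0
  | add g h _ _ hg hh => exact hg.add hh
  | smul c g _ hg => exact hg.const_mul c

/-- Trigonometric polynomials are dense in the continuous functions on the unit circle. -/
theorem exists_mem_trigPol_norm_sub_lt {G : ℂ → ℂ} (hG : ContinuousOn G (Metric.sphere 0 1))
    {ε : ℝ} (hε : 0 < ε) :
    ∃ p ∈ trigPol, ∀ w ∈ Metric.sphere (0 : ℂ) 1, ‖G w - p w‖ < ε := by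
  let f : C(AddCircle (1 : ℝ), ℂ) :=
    ⟨fun θ => G (AddCircle.toCircle θ), hG.comp_continuous
      (continuous_subtype_val.comp AddCircle.continuous_toCircle) fun θ =>
        mem_sphere_zero_iff_norm.2 (Circle.norm_coe _)⟩
  have hf : f ∈ (Submodule.span ℂ (Set.range <| @fourier (1 : ℝ))).topologicalClosure := by
    rw [span_fourier_closure_eq_top]; trivial
  obtain ⟨P, hP, hfP⟩ := Metric.mem_closure_iff.1 hf ε hε
  have key : ∀ P ∈ Submodule.span ℂ (Set.range <| @fourier (1 : ℝ)),
      ∃ p ∈ trigPol, ∀ θ : AddCircle (1 : ℝ), P θ = p (AddCircle.toCircle θ) := by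
    intro P hP
    induction hP using Submodule.span_induction with
    | mem P hP =>
      obtain ⟨n, rfl⟩ := hP
      rcases Int.eq_nat_or_neg n with ⟨s, rfl | rfl⟩
      · refine ⟨_, Submodule.subset_span ⟨s, Or.inl rfl⟩, fun θ => ?_⟩
        simp [fourier_apply, AddCircle.toCircle_nsmul]
      · refine ⟨_, Submodule.subset_span ⟨s, Or.inr rfl⟩, fun θ => ?_⟩
        rw [fourier_neg]
        simp [fourier_apply, AddCircle.toCircle_nsmul]
    | zero => exact ⟨0, Submodule.zero_mem _, fun θ => rfl⟩
    | add P Q _ _ hP hQ =>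
      obtain ⟨p, hp, h1⟩ := hP
      obtain ⟨r, hr, h2⟩ := hQ
      exact ⟨p + r, Submodule.add_mem _ hp hr, fun θ => by simp [h1, h2]⟩
    | smul c P _ hP =>
      obtain ⟨p, hp, h1⟩ := hP
      exact ⟨c • p, Submodule.smul_mem _ _ hp, fun θ => by simp [h1]⟩
  obtain ⟨p, hp, hPp⟩ := key P hP
  refine ⟨p, hp, fun w hw => ?_⟩
  have hw1 : ‖w‖ = 1 := by simpa using hw
  have hθ : (AddCircle.toCircle ((w.arg / (2 * Real.pi) : ℝ) : AddCircle (1 : ℝ)) : ℂ) = w := by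
    rw [AddCircle.toCircle_apply_mk, Circle.coe_exp]
    have h1 := Complex.norm_mul_exp_arg_mul_I w
    rw [hw1, Complex.ofReal_one, one_mul] at h1
    rw [← h1]
    congr 2
    have : Real.pi ≠ 0 := Real.pi_ne_zero
    norm_cast
    rw [h1]
    field_simp
  have h2 := (ContinuousMap.dist_lt_iff hε).1 hfP
    ((w.arg / (2 * Real.pi) : ℝ) : AddCircle (1 : ℝ))
  rw [dist_eq_norm, hPp, hθ] at h2
  simpa only [f, ContinuousMap.coe_mk, hθ] using h2

theorem exists_mem_trigPol_abs_sub_re_lt {u : ℂ → ℝ} (hu : ContinuousOn u (Metric.sphere 0 1))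
    {ε : ℝ} (hε : 0 < ε) :
    ∃ p ∈ trigPol, ∀ w ∈ Metric.sphere (0 : ℂ) 1, |u w - (p w).re| < ε := by
  obtain ⟨p, hp, h⟩ := exists_mem_trigPol_norm_sub_lt
    (Complex.continuous_ofReal.comp_continuousOn hu) hε
  refine ⟨p, hp, fun w hw => lt_of_le_of_lt ?_ (h w hw)⟩
  simpa using Complex.abs_re_le_norm ((u w : ℂ) - p w)

/-- A function of polynomial growth that is small on the unit circle is small near it, and is
dominated by a multiple of `(|w|² - 1)² (1 + |w|²) ^ d` away from it. -/
theorem PolyGrowth.exists_norm_le_add_sq_sub_one {h : ℂ → ℂ} (hh : PolyGrowth h) {ε : ℝ}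
    (hε : 0 < ε) (h1 : ∀ w ∈ Metric.sphere (0 : ℂ) 1, ‖h w‖ < ε) :
    ∃ (D : ℝ) (d : ℕ), 0 ≤ D ∧
      ∀ w, ‖h w‖ ≤ ε + D * ((‖w‖ ^ 2 - 1) ^ 2 * (1 + ‖w‖ ^ 2) ^ d) := by
  obtain ⟨E, d, hE, hEd⟩ := hh.exists_bound
  -- on the part of the disk `|w| ≤ 2` where `h` is not small, `|w|² - 1` is bounded below
  set K : Set ℂ := {w | ε ≤ ‖h w‖} ∩ Metric.closedBall 0 2 with hK
  have hKc : IsCompact K :=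
    (isCompact_closedBall (0 : ℂ) 2).inter_left (isClosed_le continuous_const hh.1.norm)
  have hKne : ∀ w ∈ K, (‖w‖ ^ 2 - 1) ^ 2 ≠ 0 := by
    intro w hw h0
    have h2 : ‖w‖ ^ 2 = 1 := by linarith [pow_eq_zero_iff (two_ne_zero) |>.1 h0]
    have h3 : ‖w‖ = 1 := (pow_eq_one_iff_of_nonneg (norm_nonneg _) two_ne_zero).1 h2
    exact absurd (h1 w (by simpa using h3)) (not_lt.2 hw.1)
  obtain ⟨C, hC⟩ := hKc.exists_bound_of_continuousOn
    (f := fun w => ‖h w‖ / (‖w‖ ^ 2 - 1) ^ 2)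
    (hh.1.norm.continuousOn.div (by fun_prop) hKne)
  refine ⟨max C 0 + E, d, by positivity, fun w => ?_⟩
  have hd1 : (1 : ℝ) ≤ (1 + ‖w‖ ^ 2) ^ d := one_le_pow₀ (by nlinarith [sq_nonneg ‖w‖])
  have hC0 := le_max_right C 0
  by_cases hw : w ∈ Metric.closedBall (0 : ℂ) 2
  · by_cases hwε : ε ≤ ‖h w‖
    · have h2 := hC w ⟨hwε, hw⟩
      have h3 : 0 < (‖w‖ ^ 2 - 1) ^ 2 := lt_of_le_of_ne (sq_nonneg _) (hKne w ⟨hwε, hw⟩).symm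
      rw [Real.norm_of_nonneg (by positivity), div_le_iff₀ h3] at h2
      calc ‖h w‖ ≤ C * (‖w‖ ^ 2 - 1) ^ 2 := h2
        _ ≤ (max C 0 + E) * ((‖w‖ ^ 2 - 1) ^ 2 * 1) := by
          rw [mul_one]
          exact mul_le_mul_of_nonneg_right (by linarith [le_max_left C 0]) h3.le
        _ ≤ (max C 0 + E) * ((‖w‖ ^ 2 - 1) ^ 2 * (1 + ‖w‖ ^ 2) ^ d) := by gcongr
        _ ≤ _ := le_add_of_nonneg_left hε.le
    · exact (not_le.1 hwε).le.trans (le_add_of_nonneg_right (by positivity))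
  · have hw2 : 2 < ‖w‖ := by simpa using hw
    have h3 : 1 ≤ (‖w‖ ^ 2 - 1) ^ 2 := one_le_pow₀ (by nlinarith)
    calc ‖h w‖ ≤ E * (1 + ‖w‖ ^ 2) ^ d := hEd w
      _ ≤ (max C 0 + E) * (1 * (1 + ‖w‖ ^ 2) ^ d) := by
        rw [one_mul]
        exact mul_le_mul_of_nonneg_right (by linarith) (by positivity)
      _ ≤ (max C 0 + E) * ((‖w‖ ^ 2 - 1) ^ 2 * (1 + ‖w‖ ^ 2) ^ d) := by gcongr
      _ ≤ _ := le_add_of_nonneg_left hε.le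

theorem integrable_of_ae_mem_sphere {E : Type*} [NormedAddCommGroup E] {ω : Measure ℂ}
    [IsFiniteMeasure ω] (hω : ∀ᵐ w ∂ω, w ∈ Metric.sphere (0 : ℂ) 1) {f : ℂ → E}
    (hf : AEStronglyMeasurable f ω) (hc : ContinuousOn f (Metric.sphere 0 1)) :
    Integrable f ω := by
  obtain ⟨C, hC⟩ := (isCompact_sphere (0 : ℂ) 1).exists_bound_of_continuousOn hc
  exact Integrable.of_bound hf C (hω.mono hC)

/-- The method of moments for probability measures that concentrate on the unit circle. -/
theorem tendsto_integral_of_tendsto_moments {ι : Type*} {l : Filter ι} {ν : ι → Measure ℂ}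
    {ω : Measure ℂ} [IsProbabilityMeasure ω] (hω : ω (Metric.sphere 0 1)ᶜ = 0)
    (hν : ∀ᶠ i in l, IsProbabilityMeasure (ν i))
    (hint : ∀ᶠ i in l, ∀ f : ℂ → ℂ, PolyGrowth f → Integrable f (ν i))
    (hmom : ∀ s : ℕ, Tendsto (fun i => ∫ w, starRingEnd ℂ w ^ s ∂ν i) l
      (𝓝 (∫ w, starRingEnd ℂ w ^ s ∂ω)))
    (hconc : ∀ d : ℕ, Tendsto (fun i => ∫ w, (‖w‖ ^ 2 - 1) ^ 2 * (1 + ‖w‖ ^ 2) ^ d ∂ν i) l (𝓝 0))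
    {g : ℂ → ℂ} (hg : PolyGrowth g) :
    Tendsto (fun i => ∫ w, g w ∂ν i) l (𝓝 (∫ w, g w ∂ω)) := by
  have hωae : ∀ᵐ w ∂ω, w ∈ Metric.sphere (0 : ℂ) 1 := hω
  have hωint : ∀ f : ℂ → ℂ, PolyGrowth f → Integrable f ω := fun f hf =>
    integrable_of_ae_mem_sphere hωae hf.1.aestronglyMeasurable hf.1.continuousOn
  have htrig : ∀ p ∈ trigPol, Tendsto (fun i => ∫ w, p w ∂ν i) l (𝓝 (∫ w, p w ∂ω)) := by
    intro p hp
    induction hp using Submodule.span_induction with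
    | mem p hp =>
      obtain ⟨s, rfl | rfl⟩ := hp
      · have h1 := (Complex.continuous_conj.tendsto _).comp (hmom s)
        simpa only [Function.comp_def, ← integral_conj, map_pow, Complex.conj_conj] using h1
      · exact hmom s
    | zero => simpa using tendsto_const_nhds
    | add p r hp hr hp' hr' =>
      have h1 := polyGrowth_of_mem_trigPol hp
      have h2 := polyGrowth_of_mem_trigPol hr
      simp only [Pi.add_apply]
      rw [integral_add (hωint p h1) (hωint r h2)]
      refine (hp'.add hr').congr' ?_
      filter_upwards [hint] with i hi
      rw [integral_add (hi p h1) (hi r h2)]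
    | smul c p _ hp' =>
      simp only [Pi.smul_apply, smul_eq_mul, integral_const_mul]
      exact hp'.const_mul c
  rw [Metric.tendsto_nhds]
  intro ε hε
  obtain ⟨p, hp, hgp⟩ := exists_mem_trigPol_norm_sub_lt hg.1.continuousOn
    (show 0 < ε / 4 by positivity)
  have hpG := polyGrowth_of_mem_trigPol hp
  obtain ⟨D, d, hD, hDd⟩ := (hg.sub hpG).exists_norm_le_add_sq_sub_one
    (show 0 < ε / 4 by positivity) hgp
  have h1 : Tendsto (fun i => D * ∫ w, (‖w‖ ^ 2 - 1) ^ 2 * (1 + ‖w‖ ^ 2) ^ d ∂ν i) l (𝓝 0) := by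
    simpa using (hconc d).const_mul D
  filter_upwards [hν, hint, h1.eventually_lt_const (show 0 < ε / 4 by positivity),
    Metric.tendsto_nhds.1 (htrig p hp) (ε / 4) (by positivity)] with i hνi hi h2 h3
  have hωgp : ‖∫ w, (p w - g w) ∂ω‖ ≤ ε / 4 := by
    refine (norm_integral_le_of_norm_le_const (C := ε / 4) (hωae.mono fun w hw => ?_)).trans ?_
    · rw [norm_sub_rev]; exact (hgp w hw).le
    · simp
  have hνgp : ‖∫ w, (g w - p w) ∂ν i‖
      ≤ ε / 4 + D * ∫ w, (‖w‖ ^ 2 - 1) ^ 2 * (1 + ‖w‖ ^ 2) ^ d ∂ν i := by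
    have hW : Integrable (fun w : ℂ => (‖w‖ ^ 2 - 1) ^ 2 * (1 + ‖w‖ ^ 2) ^ d) (ν i) := by
      have hWG : PolyGrowth fun w : ℂ =>
          (((‖w‖ ^ 2 - 1) ^ 2 * (1 + ‖w‖ ^ 2) ^ d : ℝ) : ℂ) := by
        refine ((polyGrowth_norm_sq_sub_one.pow 2).mul
          (((PolyGrowth.const 1).add (PolyGrowth.id.mul PolyGrowth.id.conj)).pow d)).congr_norm
            (by fun_prop) fun w => ?_
        congr 1
        rw [Complex.mul_conj']
        push_cast
        ring
      exact (hi _ hWG).re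
    calc ‖∫ w, (g w - p w) ∂ν i‖
        ≤ ∫ w, (ε / 4 + D * ((‖w‖ ^ 2 - 1) ^ 2 * (1 + ‖w‖ ^ 2) ^ d)) ∂ν i :=
          norm_integral_le_of_norm_le ((integrable_const _).add (hW.const_mul D))
            (Eventually.of_forall hDd)
      _ = _ := by
        rw [integral_add (integrable_const _) (hW.const_mul D), integral_const_mul]
        simp
  have hsum : ∫ w, g w ∂ν i - ∫ w, g w ∂ω = ∫ w, (g w - p w) ∂ν i
      + (∫ w, p w ∂ν i - ∫ w, p w ∂ω) + ∫ w, (p w - g w) ∂ω := by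
    rw [integral_sub (hi g hg) (hi p hpG), integral_sub (hωint p hpG) (hωint g hg)]
    ring
  rw [dist_eq_norm] at h3 ⊢
  rw [hsum]
  refine (norm_add₃_le).trans_lt ?_
  linarith

/-! ### The maximum principle in the exterior disk -/

theorem exteriorDisk_eq : exteriorDisk = (Metric.closedBall (0 : ℂ) 1)ᶜ := by
  ext w; simp [exteriorDisk]

theorem frontier_exteriorDisk : frontier exteriorDisk = Metric.sphere 0 1 := by
  rw [exteriorDisk_eq, frontier_compl, frontier_closedBall _ one_ne_zero]

theorem closure_exteriorDisk : closure exteriorDisk = {w : ℂ | 1 ≤ ‖w‖} := by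
  rw [exteriorDisk_eq, closure_compl, interior_closedBall _ one_ne_zero]
  ext w; simp

/-- A harmonic function with a maximum at an interior point is constant near that point. -/
theorem InnerProductSpace.HarmonicOnNhd.eventually_eq_of_isMaxOn {v : ℂ → ℝ} {U : Set ℂ}
    (hU : IsOpen U)
    (hv : InnerProductSpace.HarmonicOnNhd v U) {c : ℂ} (hc : c ∈ U) (hmax : ∀ w ∈ U, v w ≤ v c) :
    ∀ᶠ w in 𝓝 c, v w = v c := by
  obtain ⟨r, hr, hrU⟩ := Metric.isOpen_iff.1 hU c hc
  obtain ⟨F, hF, hFv⟩ := InnerProductSpace.HarmonicOnNhd.exists_analyticOnNhd_ball_re_eq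
    (hv.mono hrU)
  have hball := Metric.ball_mem_nhds c hr
  have hexp : ∀ w ∈ Metric.ball c r, ‖Complex.exp (F w)‖ = Real.exp (v w) := fun w hw => by
    rw [Complex.norm_exp]; exact congr_arg Real.exp (hFv hw)
  have h1 := Complex.norm_eventually_eq_of_isLocalMax (f := fun w => Complex.exp (F w)) (c := c)
    (by
      filter_upwards [hball] with w hw
      exact (hF w hw).differentiableAt.cexp)
    (by
      filter_upwards [hball] with w hw
      simp only [Function.comp_apply]
      rw [hexp w hw, hexp c (Metric.mem_ball_self hr)]
      exact Real.exp_le_exp.2 (hmax w (hrU hw)))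
  filter_upwards [h1, hball] with w hw hwb
  rw [hexp w hwb, hexp c (Metric.mem_ball_self hr)] at hw
  exact Real.exp_injective hw

/-- The maximum principle in the annulus `1 < |w| < R`. -/
theorem le_of_harmonicOnNhd_annulus {v : ℂ → ℝ} {R A : ℝ}
    (hv : InnerProductSpace.HarmonicOnNhd v {w : ℂ | 1 < ‖w‖ ∧ ‖w‖ < R})
    (hc : ContinuousOn v {w : ℂ | 1 ≤ ‖w‖ ∧ ‖w‖ ≤ R}) (h1 : ∀ w, ‖w‖ = 1 → v w ≤ A)
    (hR : ∀ w, ‖w‖ = R → v w ≤ A) {z : ℂ} (hz1 : 1 ≤ ‖z‖) (hzR : ‖z‖ ≤ R) : v z ≤ A := by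
  set K : Set ℂ := {w : ℂ | 1 ≤ ‖w‖ ∧ ‖w‖ ≤ R} with hK
  have hKc : IsCompact K := by
    refine (isCompact_closedBall (0 : ℂ) R).of_isClosed_subset
      ((isClosed_le continuous_const continuous_norm).inter
        (isClosed_le continuous_norm continuous_const)) fun w hw => ?_
    simpa using hw.2
  obtain ⟨c₀, hc₀, hmax₀⟩ := hKc.exists_isMaxOn ⟨z, hz1, hzR⟩ hc
  -- among the points where the maximum is attained, take one with the largest modulus
  have hK'c : IsCompact (K ∩ v ⁻¹' Set.Ici (v c₀)) :=
    hKc.of_isClosed_subset (hc.preimage_isClosed_of_isClosed hKc.isClosed isClosed_Ici)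
      Set.inter_subset_left
  obtain ⟨c, ⟨hcK, hcv⟩, hcmax⟩ := hK'c.exists_isMaxOn ⟨c₀, hc₀, le_refl (v c₀)⟩
    continuous_norm.continuousOn
  have hcv' : v c₀ ≤ v c := hcv
  have hmax : ∀ w ∈ K, v w ≤ v c := fun w hw => (hmax₀ hw).trans hcv'
  refine (hmax z ⟨hz1, hzR⟩).trans ?_
  rcases hcK.1.eq_or_lt with h | hlt1
  · exact h1 c h.symm
  rcases hcK.2.eq_or_lt with h | hltR
  · exact hR c h
  exfalso
  have hU : IsOpen {w : ℂ | 1 < ‖w‖ ∧ ‖w‖ < R} :=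
    (isOpen_lt continuous_const continuous_norm).inter (isOpen_lt continuous_norm continuous_const)
  have h2 := InnerProductSpace.HarmonicOnNhd.eventually_eq_of_isMaxOn hU hv ⟨hlt1, hltR⟩
    fun w hw => hmax w ⟨hw.1.le, hw.2.le⟩
  have h3 : ∀ᶠ w in 𝓝 c, v w = v c ∧ w ∈ {w : ℂ | 1 < ‖w‖ ∧ ‖w‖ < R} :=
    h2.and (hU.mem_nhds ⟨hlt1, hltR⟩)
  have h4 : Tendsto (fun t : ℝ => ((1 + t : ℝ) : ℂ) * c) (𝓝[>] 0) (𝓝 c) := by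
    have : Tendsto (fun t : ℝ => ((1 + t : ℝ) : ℂ) * c) (𝓝 0) (𝓝 (((1 + (0 : ℝ) : ℝ) : ℂ) * c)) :=
      (by fun_prop : Continuous fun t : ℝ => ((1 + t : ℝ) : ℂ) * c).tendsto 0
    simpa using this.mono_left nhdsWithin_le_nhds
  obtain ⟨t, ⟨ht1, ht2⟩, ht0⟩ := ((h4.eventually h3).and self_mem_nhdsWithin).exists
  have ht0' : 0 < t := ht0
  have h5 : ‖((1 + t : ℝ) : ℂ) * c‖ ≤ ‖c‖ := hcmax ⟨⟨ht2.1.le, ht2.2.le⟩, by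
    simp only [Set.mem_preimage, Set.mem_Ici]
    rw [ht1]; exact hcv'⟩
  rw [norm_mul, Complex.norm_real, Real.norm_of_nonneg (by positivity)] at h5
  nlinarith

/-- The maximum principle for bounded harmonic functions in the exterior disk. The barrier
`δ log |w|` makes up for the lack of control at infinity. -/
theorem le_of_harmonicContOnCl_exteriorDisk {u : ℂ → ℝ}
    (hu : InnerProductSpace.HarmonicContOnCl u exteriorDisk) {C A : ℝ}
    (hC : ∀ w ∈ exteriorDisk, |u w| ≤ C) (hA : ∀ w ∈ Metric.sphere (0 : ℂ) 1, u w ≤ A)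
    {z : ℂ} (hz : z ∈ exteriorDisk) : u z ≤ A := by
  have hz1 : 1 < ‖z‖ := hz
  refine le_of_forall_pos_le_add fun ε hε => ?_
  have hlogz : 0 < Real.log ‖z‖ := Real.log_pos hz1
  set δ := ε / Real.log ‖z‖ with hδ
  have hδ0 : 0 < δ := by positivity
  have hlim : Tendsto (fun R : ℝ => δ * Real.log R) atTop atTop :=
    Real.tendsto_log_atTop.const_mul_atTop hδ0
  obtain ⟨R, hR1, hR2⟩ := ((hlim.eventually_ge_atTop (C - A)).and (eventually_ge_atTop ‖z‖)).exists
  have hv := le_of_harmonicOnNhd_annulus (v := fun w => u w - δ * Real.log ‖w‖) (R := R) (A := A)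
    (by
      intro w hw
      have hw0 : w ≠ 0 := norm_pos_iff.1 (zero_lt_one.trans hw.1)
      have h1 : InnerProductSpace.HarmonicAt (fun w : ℂ => Real.log ‖w‖) w :=
        AnalyticAt.harmonicAt_log_norm analyticAt_id hw0
      exact (hu.1 w hw.1).sub (h1.const_smul (c := δ)))
    (by
      refine (hu.2.mono fun w hw => ?_).sub (continuousOn_const.mul
        (continuous_norm.continuousOn.log fun w hw => ?_))
      · rw [closure_exteriorDisk]; exact hw.1
      · exact (zero_lt_one.trans_le hw.1).ne')
    (fun w hw => by
      rw [hw, Real.log_one, mul_zero, sub_zero]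
      exact hA w (by simpa using hw))
    (fun w hw => by
      have hw1 : w ∈ exteriorDisk := by
        change 1 < ‖w‖
        rw [hw]; linarith
      have h2 := (abs_le.1 (hC w hw1)).2
      rw [hw]
      linarith)
    hz1.le hR2
  have h3 : δ * Real.log ‖z‖ = ε := by rw [hδ]; field_simp
  linarith

/-! ### Harmonic measure of the exterior disk -/

/-- The harmonic extension of a trigonometric polynomial to the exterior disk: the composition with
the reflection `w ↦ 1 / conj w` in the unit circle. -/
theorem harmonicAt_trigPol_reflection {p : ℂ → ℂ} (hp : p ∈ trigPol) {w : ℂ} (hw : w ≠ 0) :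
    InnerProductSpace.HarmonicAt (fun w => p (starRingEnd ℂ w⁻¹)) w := by
  have han : ∀ s : ℕ, AnalyticAt ℂ (fun w : ℂ => w⁻¹ ^ s) w := fun s =>
    (analyticAt_id.inv hw).pow s
  induction hp using Submodule.span_induction with
  | mem g hg =>
    obtain ⟨s, rfl | rfl⟩ := hg
    · have h1 := (han s).harmonicAt.comp_CLM (Complex.conjCLE : ℂ →L[ℝ] ℂ)
      refine (InnerProductSpace.harmonicAt_congr_nhds (Eventually.of_forall fun y => ?_)).1 h1
      simp
    · simpa using (han s).harmonicAt
  | zero => exact InnerProductSpace.harmonicAt_const 0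
  | add g h _ _ hg hh => exact hg.add hh
  | smul c g _ hg => exact hg.comp_CLM ((ContinuousLinearMap.mul ℝ ℂ) c)

theorem reflection_of_mem_sphere {w : ℂ} (hw : w ∈ Metric.sphere (0 : ℂ) 1) :
    starRingEnd ℂ w⁻¹ = w := by
  have hw1 : ‖w‖ = 1 := by simpa using hw
  rw [Complex.inv_eq_conj hw1, Complex.conj_conj]

theorem harmonicContOnCl_trigPol_reflection {p : ℂ → ℂ} (hp : p ∈ trigPol) :
    InnerProductSpace.HarmonicContOnCl (fun w => (p (starRingEnd ℂ w⁻¹)).re) exteriorDisk := by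
  refine InnerProductSpace.HarmonicOnNhd.harmonicContOnCl fun w hw => ?_
  rw [closure_exteriorDisk] at hw
  exact (harmonicAt_trigPol_reflection hp (norm_pos_iff.1 (zero_lt_one.trans_le hw))).comp_CLM
    Complex.reCLM

theorem exists_bound_trigPol_reflection {p : ℂ → ℂ} (hp : p ∈ trigPol) :
    ∃ C : ℝ, ∀ w ∈ exteriorDisk, |(p (starRingEnd ℂ w⁻¹)).re| ≤ C := by
  obtain ⟨C, hC⟩ := (isCompact_closedBall (0 : ℂ) 1).exists_bound_of_continuousOn
    (polyGrowth_of_mem_trigPol hp).1.continuousOn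
  refine ⟨C, fun w hw => (Complex.abs_re_le_norm _).trans (hC _ ?_)⟩
  have hw1 : 1 < ‖w‖ := hw
  simpa using inv_le_one_of_one_le₀ hw1.le

/-- A probability measure on the circle that integrates trigonometric polynomials like evaluation
at the reflected point `1 / conj z` is a harmonic measure at `z` for the exterior disk. -/
theorem isHarmonicMeasure_of_integral_trigPol {z : ℂ} (hz : z ∈ exteriorDisk) {ω : Measure ℂ}
    [IsProbabilityMeasure ω] (hω : ω (Metric.sphere 0 1)ᶜ = 0)
    (h : ∀ p ∈ trigPol, ∫ w, p w ∂ω = p (starRingEnd ℂ z⁻¹)) :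
    IsHarmonicMeasure exteriorDisk z ω := by
  have hωae : ∀ᵐ w ∂ω, w ∈ Metric.sphere (0 : ℂ) 1 := hω
  refine ⟨inferInstance, by rwa [frontier_exteriorDisk], fun u hu ⟨C, hC⟩ => ?_⟩
  have hrestr : ω.restrict (Metric.sphere 0 1) = ω := Measure.restrict_eq_self_of_ae_mem hωae
  have hucont : ContinuousOn u (Metric.sphere 0 1) := hu.2.mono fun w hw => by
    rw [closure_exteriorDisk]
    exact (show ‖w‖ = 1 by simpa using hw).ge
  have humeas : AEStronglyMeasurable u ω := by
    rw [← hrestr]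
    exact hucont.aestronglyMeasurable Metric.isClosed_sphere.measurableSet
  rw [frontier_exteriorDisk, hrestr]
  refine eq_of_abs_sub_le_all fun ε hε => ?_
  obtain ⟨p, hp, hup⟩ := exists_mem_trigPol_abs_sub_re_lt hucont (half_pos hε)
  have hpG := polyGrowth_of_mem_trigPol hp
  have hH := harmonicContOnCl_trigPol_reflection hp
  obtain ⟨C', hC'⟩ := exists_bound_trigPol_reflection hp
  have h1 : u z - (p (starRingEnd ℂ z⁻¹)).re ≤ ε / 2 :=
    le_of_harmonicContOnCl_exteriorDisk (hu.fun_sub hH) (C := C + C')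
      (fun w hw => (abs_sub _ _).trans (add_le_add (hC w hw) (hC' w hw)))
      (fun w hw => by
        rw [reflection_of_mem_sphere hw]; exact (abs_lt.1 (hup w hw)).2.le) hz
  have h2 : (p (starRingEnd ℂ z⁻¹)).re - u z ≤ ε / 2 :=
    le_of_harmonicContOnCl_exteriorDisk (hH.fun_sub hu) (C := C' + C)
      (fun w hw => (abs_sub _ _).trans (add_le_add (hC' w hw) (hC w hw)))
      (fun w hw => by
        rw [reflection_of_mem_sphere hw]; linarith [(abs_lt.1 (hup w hw)).1]) hz
  have hpint : Integrable p ω :=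
    integrable_of_ae_mem_sphere hωae hpG.1.aestronglyMeasurable hpG.1.continuousOn
  have hpre : Integrable (fun w => (p w).re) ω := hpint.re
  have h3 : (p (starRingEnd ℂ z⁻¹)).re = ∫ w, (p w).re ∂ω := by
    rw [← h p hp]
    exact (integral_re hpint).symm
  have h4 : |∫ w, u w ∂ω - ∫ w, (p w).re ∂ω| ≤ ε / 2 := by
    rw [← integral_sub (integrable_of_ae_mem_sphere hωae humeas hucont) hpre,
      ← Real.norm_eq_abs]
    refine (norm_integral_le_of_norm_le_const (C := ε / 2) (hωae.mono fun w hw => ?_)).trans ?_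
    · exact (hup w hw).le
    · simp
  rw [h3] at h1 h2
  rw [abs_le] at h4 ⊢
  constructor <;> linarith [h4.1, h4.2]

/-- There is at most one harmonic measure for the exterior disk. -/
theorem IsHarmonicMeasure.unique_exteriorDisk {z : ℂ} {ω ω' : Measure ℂ}
    (hω : IsHarmonicMeasure exteriorDisk z ω) (hω' : IsHarmonicMeasure exteriorDisk z ω') :
    ω = ω' := by
  have key : ∀ ν, IsHarmonicMeasure exteriorDisk z ν → (∀ᵐ w ∂ν, w ∈ Metric.sphere (0 : ℂ) 1) ∧
      ∀ p ∈ trigPol, ∫ w, (p w).re ∂ν = (p (starRingEnd ℂ z⁻¹)).re := by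
    intro ν hν
    have hνae : ∀ᵐ w ∂ν, w ∈ Metric.sphere (0 : ℂ) 1 := by
      have := hν.carried
      rwa [frontier_exteriorDisk] at this
    refine ⟨hνae, fun p hp => ?_⟩
    have h1 := hν.dirichlet _ (harmonicContOnCl_trigPol_reflection hp)
      (exists_bound_trigPol_reflection hp)
    rw [frontier_exteriorDisk, Measure.restrict_eq_self_of_ae_mem hνae] at h1
    rw [h1]
    exact integral_congr_ae (hνae.mono fun w hw => by simp only [reflection_of_mem_sphere hw])
  have := hω.isProbabilityMeasure
  have := hω'.isProbabilityMeasure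
  refine ext_of_forall_integral_eq_of_IsFiniteMeasure fun f => ?_
  refine eq_of_abs_sub_le_all fun ε hε => ?_
  obtain ⟨p, hp, hfp⟩ := exists_mem_trigPol_abs_sub_re_lt f.continuous.continuousOn (half_pos hε)
  have key2 : ∀ ν, IsHarmonicMeasure exteriorDisk z ν →
      |∫ w, f w ∂ν - (p (starRingEnd ℂ z⁻¹)).re| ≤ ε / 2 := by
    intro ν hν
    have := hν.isProbabilityMeasure
    obtain ⟨hνae, hνp⟩ := key ν hν
    have hpc := (polyGrowth_of_mem_trigPol hp).1
    have hpre : Integrable (fun w => (p w).re) ν :=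
      (integrable_of_ae_mem_sphere hνae hpc.aestronglyMeasurable hpc.continuousOn).re
    rw [← hνp p hp, ← integral_sub (f.integrable ν) hpre, ← Real.norm_eq_abs]
    refine (norm_integral_le_of_norm_le_const (C := ε / 2) (hνae.mono fun w hw => ?_)).trans ?_
    · exact (hfp w hw).le
    · simp
  have h1 := abs_le.1 (key2 ω hω)
  have h2 := abs_le.1 (key2 ω' hω')
  rw [abs_le]
  constructor <;> linarith [h1.1, h1.2, h2.1, h2.2]

/-- The harmonic measure at the exterior point `z`: the Poisson kernel of the unit disk at the
reflected point `1 / conj z`, times the normalized arc length. -/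
noncomputable def exteriorPoissonMeasure (z : ℂ) : Measure ℂ :=
  ((volume.restrict (Set.Ioc 0 (2 * Real.pi))).withDensity fun θ => ENNReal.ofReal
    ((2 * Real.pi)⁻¹ * poissonKernel 0 (starRingEnd ℂ z⁻¹) (circleMap 0 1 θ))).map (circleMap 0 1)

section Poisson
variable {z : ℂ}

theorem reflection_mem_ball (hz : z ∈ exteriorDisk) :
    starRingEnd ℂ z⁻¹ ∈ Metric.ball (0 : ℂ) 1 := by
  have hz1 : 1 < ‖z‖ := hz
  simpa using inv_lt_one_of_one_lt₀ hz1

theorem integral_exteriorPoissonMeasure (hz : z ∈ exteriorDisk) {f : ℂ → ℂ} (hf : Continuous f) :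
    ∫ w, f w ∂exteriorPoissonMeasure z
      = Real.circleAverage (poissonKernel 0 (starRingEnd ℂ z⁻¹) • f) 0 1 := by
  have hb := reflection_mem_ball hz
  have hpos : ∀ θ, 0 ≤ poissonKernel 0 (starRingEnd ℂ z⁻¹) (circleMap 0 1 θ) := fun θ => by
    rw [poissonKernel_def]
    have h1 : ‖starRingEnd ℂ z⁻¹‖ < 1 := by simpa using hb
    refine div_nonneg ?_ (by positivity)
    simp only [sub_zero, norm_circleMap_zero, abs_one, one_pow]
    nlinarith [norm_nonneg (starRingEnd ℂ z⁻¹)]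
  have hmeas : Measurable fun θ : ℝ =>
      (2 * Real.pi)⁻¹ * poissonKernel 0 (starRingEnd ℂ z⁻¹) (circleMap 0 1 θ) := by
    simp only [poissonKernel_def]
    have := (continuous_circleMap 0 1).measurable
    fun_prop
  rw [exteriorPoissonMeasure, integral_map (continuous_circleMap 0 1).aemeasurable
    hf.aestronglyMeasurable, integral_withDensity_eq_integral_toReal_smul (by fun_prop)
    (Eventually.of_forall fun _ => ENNReal.ofReal_lt_top), Real.circleAverage_def,
    intervalIntegral.integral_of_le (by positivity), ← integral_smul]
  refine integral_congr_ae (Eventually.of_forall fun θ => ?_)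
  have := hpos θ
  simp only [Pi.smul_apply']
  rw [ENNReal.toReal_ofReal (by positivity), mul_smul]

theorem isProbabilityMeasure_exteriorPoissonMeasure (hz : z ∈ exteriorDisk) :
    IsProbabilityMeasure (exteriorPoissonMeasure z) := by
  have h1 := integral_exteriorPoissonMeasure hz (f := fun _ => 1) continuous_const
  rw [DiffContOnCl.circleAverage_poissonKernel_smul diffContOnCl_const (reflection_mem_ball hz),
    integral_const] at h1
  have h2 : (exteriorPoissonMeasure z).real Set.univ = 1 := by
    rw [Complex.real_smul, mul_one] at h1
    exact_mod_cast h1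
  exact ⟨(ENNReal.toReal_eq_one_iff _).1 h2⟩

theorem exteriorPoissonMeasure_compl_sphere :
    exteriorPoissonMeasure z (Metric.sphere 0 1)ᶜ = 0 := by
  rw [exteriorPoissonMeasure, Measure.map_apply (continuous_circleMap 0 1).measurable
    Metric.isClosed_sphere.measurableSet.compl]
  have h : circleMap 0 1 ⁻¹' (Metric.sphere 0 1)ᶜ = ∅ := by
    ext θ; simp
  rw [h, measure_empty]

theorem integral_trigPol_exteriorPoissonMeasure (hz : z ∈ exteriorDisk) {p : ℂ → ℂ}
    (hp : p ∈ trigPol) : ∫ w, p w ∂exteriorPoissonMeasure z = p (starRingEnd ℂ z⁻¹) := by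
  have := isProbabilityMeasure_exteriorPoissonMeasure hz
  have hae : ∀ᵐ w ∂exteriorPoissonMeasure z, w ∈ Metric.sphere (0 : ℂ) 1 :=
    exteriorPoissonMeasure_compl_sphere
  have hint : ∀ f ∈ trigPol, Integrable f (exteriorPoissonMeasure z) := by
    intro f hf
    have hfc := (polyGrowth_of_mem_trigPol hf).1
    exact integrable_of_ae_mem_sphere hae hfc.aestronglyMeasurable hfc.continuousOn
  have hpow : ∀ s : ℕ, ∫ w, w ^ s ∂exteriorPoissonMeasure z = (starRingEnd ℂ z⁻¹) ^ s := by
    intro s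
    rw [integral_exteriorPoissonMeasure hz (by fun_prop)]
    exact DiffContOnCl.circleAverage_poissonKernel_smul
      (Differentiable.diffContOnCl (by fun_prop)) (reflection_mem_ball hz)
  induction hp using Submodule.span_induction with
  | mem g hg =>
    obtain ⟨s, rfl | rfl⟩ := hg
    · exact hpow s
    · have h1 := congr_arg (starRingEnd ℂ) (hpow s)
      rw [← integral_conj] at h1
      simpa only [map_pow] using h1
  | zero => simp
  | add g h hg' hh' hg hh =>
    simp only [Pi.add_apply]
    rw [integral_add (hint g hg') (hint h hh'), hg, hh]
  | smul c g _ hg =>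
    simp only [Pi.smul_apply, smul_eq_mul, integral_const_mul, hg]

theorem harmonicMeasure_exteriorDisk (hz : z ∈ exteriorDisk) :
    harmonicMeasure exteriorDisk z = exteriorPoissonMeasure z := by
  have := isProbabilityMeasure_exteriorPoissonMeasure hz
  have h1 : IsHarmonicMeasure exteriorDisk z (exteriorPoissonMeasure z) :=
    isHarmonicMeasure_of_integral_trigPol hz exteriorPoissonMeasure_compl_sphere
      fun p hp => integral_trigPol_exteriorPoissonMeasure hz hp
  have h : ∃! ω, IsHarmonicMeasure exteriorDisk z ω :=
    ⟨_, h1, fun ω hω => hω.unique_exteriorDisk h1⟩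
  rw [harmonicMeasure, dif_pos h]
  exact h.choose_spec.1.unique_exteriorDisk h1

end Poisson

/-! ### Convergence of the Berezin measures -/

section Berezin
variable {m : ℝ}

/-- The probability measure with density `|ψ|²` against the Gaussian measure, for the Berezin state
`ψ` at `z`. -/
noncomputable def berezinMeasure (m : ℝ) (n q : ℕ) (z : ℂ) : Measure ℂ :=
  (fockMeasure m).withDensity fun w => ENNReal.ofReal (‖berezinState m n q z w‖ ^ 2)

theorem integral_berezinMeasure {E : Type*} [NormedAddCommGroup E] [NormedSpace ℝ E] (hm : 0 < m)
    (n q : ℕ) (z : ℂ) (f : ℂ → E) :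
    ∫ w, f w ∂berezinMeasure m n q z
      = ∫ w, ‖berezinState m n q z w‖ ^ 2 • f w ∂fockMeasure m := by
  have hc := (polyGrowth_of_mem (berezinState_mem hm n q z)).1
  rw [berezinMeasure, integral_withDensity_eq_integral_toReal_smul (by fun_prop)
    (Eventually.of_forall fun _ => ENNReal.ofReal_lt_top)]
  refine integral_congr_ae (Eventually.of_forall fun w => ?_)
  simp only [ENNReal.toReal_ofReal (sq_nonneg ‖berezinState m n q z w‖)]

theorem PolyGrowth.integrable_berezinMeasure (hm : 0 < m) (n q : ℕ) (z : ℂ) {f : ℂ → ℂ}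
    (hf : PolyGrowth f) : Integrable f (berezinMeasure m n q z) := by
  have hψ := polyGrowth_of_mem (berezinState_mem hm n q z)
  have hc := hψ.1
  rw [berezinMeasure, integrable_withDensity_iff_integrable_smul' (by fun_prop)
    (Eventually.of_forall fun _ => ENNReal.ofReal_lt_top)]
  refine (((hψ.mul hψ.conj).mul hf).integrable hm).congr (Eventually.of_forall fun w => ?_)
  simp only [ENNReal.toReal_ofReal (sq_nonneg ‖berezinState m n q z w‖), Complex.mul_conj',
    Complex.real_smul, Complex.ofReal_pow]

theorem isProbabilityMeasure_berezinMeasure (hm : 0 < m) {n q : ℕ} (hn : 1 ≤ n) (hq : 1 ≤ q)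
    (z : ℂ) : IsProbabilityMeasure (berezinMeasure m n q z) := by
  have h1 := integral_berezinMeasure hm n q z (fun _ => (1 : ℝ))
  simp only [smul_eq_mul, mul_one] at h1
  rw [← fockNorm_sq, fockNorm_berezinState hm hn hq, integral_const, smul_eq_mul, mul_one,
    one_pow] at h1
  exact ⟨(ENNReal.toReal_eq_one_iff _).1 h1⟩

end Berezin

theorem mainTheorem2 (q : ℕ) (hq : 1 ≤ q) (z : ℂ) (hz : z ∈ exteriorDisk)
    (g : ℂ → ℂ) (hg : Continuous g) (hgb : ∃ C : ℝ, ∀ w, ‖g w‖ ≤ C) (M : ℝ) :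
    Tendsto
      (fun p : ℝ × ℕ => ∫ w, g w * (berezinDensity p.1 p.2 q z w : ℂ) ∂normalizedArea)
      (nearDiagonal M)
      (𝓝 (∫ w, g w ∂(harmonicMeasure exteriorDisk z))) := by
  have hz1 : 1 < ‖z‖ := hz
  obtain ⟨C, hC⟩ := hgb
  have hm : ∀ᶠ p : ℝ × ℕ in nearDiagonal M, 0 < p.1 :=
    tendsto_fst_nearDiagonal.eventually_gt_atTop 0
  have hn : ∀ᶠ p : ℝ × ℕ in nearDiagonal M, 1 ≤ p.2 :=
    tendsto_snd_nearDiagonal.eventually_ge_atTop 1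
  have := isProbabilityMeasure_exteriorPoissonMeasure hz
  have key := tendsto_integral_of_tendsto_moments (l := nearDiagonal M)
    (ν := fun p : ℝ × ℕ => berezinMeasure p.1 p.2 q z) (ω := exteriorPoissonMeasure z)
    exteriorPoissonMeasure_compl_sphere
    (by
      filter_upwards [hm, hn] with p hp0 hp1
      exact isProbabilityMeasure_berezinMeasure hp0 hp1 hq z)
    (by
      filter_upwards [hm] with p hp0 f hf
      exact hf.integrable_berezinMeasure hp0 p.2 q z)
    (by
      intro s
      have h1 := integral_trigPol_exteriorPoissonMeasure hz
        (Submodule.subset_span ⟨s, Or.inr rfl⟩ : (fun w => starRingEnd ℂ w ^ s) ∈ trigPol)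
      rw [h1, Complex.conj_conj, inv_pow]
      refine (tendsto_fockInner_conj_pow_mul_berezinState (M := M) hq hz1 s).congr' ?_
      filter_upwards [hm] with p hp0
      rw [integral_berezinMeasure hp0, fockInner]
      refine integral_congr_ae (Eventually.of_forall fun w => ?_)
      simp only [mul_assoc, Complex.mul_conj', Complex.real_smul, Complex.ofReal_pow]
      ring)
    (by
      intro d
      refine (tendsto_integral_sq_sub_one_mul_berezinState (M := M) hq hz1 d).congr' ?_
      filter_upwards [hm] with p hp0
      rw [integral_berezinMeasure hp0]
      refine integral_congr_ae (Eventually.of_forall fun w => ?_)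
      simp only [smul_eq_mul]
      ring)
    (PolyGrowth.of_bounded hg hC)
  rw [harmonicMeasure_exteriorDisk hz]
  refine key.congr' ?_
  filter_upwards [hm, hn] with p hp0 hp1
  rw [integral_berezinMeasure hp0, integral_mul_berezinDensity hp0 hp1 hq]
  refine integral_congr_ae (Eventually.of_forall fun w => ?_)
  simp only [Complex.real_smul]
  ring
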